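/- Let $\Omega\subset\mathbb R^3$ be a bounded domain (open, connected) with smooth boundary, let $T>0$, $n\in\mathbb N$, and let $D_{ij}=D_{ji}>0$ ($i\neq j$, $1\le i,j\le n$) be given coefficients (the terms with $i=j$ in the sums below vanish, and the values $D_{ii}$ play no role). Let $c_i^0:\Omega\to\mathbb R$ satisfy $c_i^0\ge 0$ and $\sum_{i=1}^n c_i^0=1$ a.e. in $\Omega$. A vector $\boldsymbol c=(c_1,\dots,c_n)$ with $c_i\in L^2(0,T;H^1(\Omega))$ and $\partial_t c_i\in L^2(0,T;H^1(\Omega)^*)$ is called a weak solution of the Maxwell–Stefan system, with no-flux boundary conditions and initial data $\boldsymbol c^0$, if (i) for all $i$ and all $\varphi\in C^1_c(\overline\Omega\times(0,T))$, $$\int_0^T\!\!\int_\Omega c_i\,\partial_t\varphi\,dx\,dt+\int_0^T\!\!\int_\Omega \sqrt{c_i}\,m_i\cdot\nabla\varphi\,dx\,dt=0,$$ where $m=(m_1,\dots,m_n)$, $m_i:\Omega\times(0,T)\to\mathbb R^3$, solves a.e. in $\Omega\times(0,T)$ the linear system $$-\sum_{j=1}^nA_{ij}m_j=2\nabla\sqrt{c_i}\quad(1\le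 i\le n),\qquad \sum_{i=1}^n\sqrt{c_i}\,m_i=0,$$ with $A_{ij}=-\sqrt{c_ic_j}/D_{ij}$ for $i\ne j$ and $A_{ii}=\sum_{k\neq i}c_k/D_{ik}$; (ii) $c_i\in L^\infty(0,T;L^\infty(\Omega))$ for all $i$; (iii) $c_i\ge0$ for all $i$ and $\sum_{i=1}^n c_i=1$, a.e. in $\Omega\times[0,T]$; (iv) $\sqrt{c_i}\in L^2(0,T;H^1(\Omega))$ and $c_i\in C([0,T];L^2(\Omega))$, with $c_i(0)=c_i^0$ in $L^2(\Omega)$, for all $i$. The velocities $u_i$ are defined by $m_i=\sqrt{c_i}\,u_i$ where $c_i>0$; where $c_ic_j=0$ the expression $c_ic_j|u_i-u_j|^2$ is understood as $0$. Put $$H(\boldsymbol c)=\sum_{i=1}^n\int_\Omega c_i(\ln c_i-1)\,dx,\qquad 0\ln 0:=0 .$$ Then every weak solution $\boldsymbol c$ satisfies the entropy equality $$H(\boldsymbol c(t))+\frac12\sum_{i,j=1}^n\int_0^t\!\!\int_\Omega\frac{c_ic_j}{D_{ij}}\,|u_i-u_j|^2\,dx\,ds=H(\boldsymbol c^0)\qquad\text{for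 every }t\in(0,T],$$ all the integrals involved being integrals of integrable functions. -/

import Mathlib

open MeasureTheory Set Filter Topology
open scoped ContDiff ENNReal

namespace MaxwellStefan

noncomputable section

/-- Physical space `ℝ³` with its Euclidean norm. -/
abbrev Space : Type := EuclideanSpace ℝ (Fin 3)

/-- Bounded domains (open connected sets) of `ℝ³` with smooth boundary: near every boundary point
the set is the region `ρ < 0` for a smooth function `ρ` with nonvanishing derivative there. -/
structure IsBoundedSmoothDomain (Ω : Set Space) : Prop where
  isOpen : IsOpen Ω
  isConnected : IsConnected Ω
  isBounded : Bornology.IsBounded Ω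
  smooth_boundary : ∀ x₀ ∈ frontier Ω, ∃ (U : Set Space) (ρ : Space → ℝ),
    IsOpen U ∧ x₀ ∈ U ∧ ContDiffOn ℝ ∞ ρ U ∧ fderiv ℝ ρ x₀ ≠ 0 ∧
      ∀ x ∈ U, x ∈ Ω ↔ ρ x < 0

/-- `f ∈ H¹(Ω)` with weak gradient `g`. -/
structure HasH1Gradient (Ω : Set Space) (f : Space → ℝ) (g : Space → Space) : Prop where
  memLp : MemLp f 2 (volume.restrict Ω)
  memLp_gradient : MemLp g 2 (volume.restrict Ω)
  integral_eq : ∀ φ : Space → ℝ, ContDiff ℝ ∞ φ → HasCompactSupport φ → tsupport φ ⊆ Ω →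
    ∀ v : Space, ∫ x in Ω, f x * fderiv ℝ φ x v = -∫ x in Ω, inner ℝ (g x) v * φ x

theorem HasH1Gradient.congr {Ω : Set Space} {f f' : Space → ℝ} {g g' : Space → Space}
    (h : HasH1Gradient Ω f g) (hf : f =ᵐ[volume.restrict Ω] f')
    (hg : g =ᵐ[volume.restrict Ω] g') : HasH1Gradient Ω f' g' where
  memLp := (memLp_congr_ae hf).1 h.memLp
  memLp_gradient := (memLp_congr_ae hg).1 h.memLp_gradient
  integral_eq φ h₁ h₂ h₃ v := by
    have e₁ : ∫ x in Ω, f' x * fderiv ℝ φ x v = ∫ x in Ω, f x * fderiv ℝ φ x v := by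
      refine integral_congr_ae ?_
      filter_upwards [hf] with x hx
      rw [hx]
    have e₂ : ∫ x in Ω, inner ℝ (g' x) v * φ x = ∫ x in Ω, inner ℝ (g x) v * φ x := by
      refine integral_congr_ae ?_
      filter_upwards [hg] with x hx
      rw [hx]
    rw [e₁, e₂]
    exact h.integral_eq φ h₁ h₂ h₃ v

theorem integrable_mul_of_test {Ω : Set Space} {f φ : Space → ℝ}
    (hf : MemLp f 2 (volume.restrict Ω)) (hφ : Continuous φ) (hc : HasCompactSupport φ) :
    Integrable (fun x => f x * φ x) (volume.restrict Ω) :=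
  hf.integrable_mul (q := 2) ((hφ.memLp_of_hasCompactSupport hc).restrict Ω)

theorem integrable_mul_fderiv {Ω : Set Space} {f φ : Space → ℝ}
    (hf : MemLp f 2 (volume.restrict Ω)) (hφ : ContDiff ℝ ∞ φ) (hc : HasCompactSupport φ)
    (v : Space) : Integrable (fun x => f x * fderiv ℝ φ x v) (volume.restrict Ω) :=
  integrable_mul_of_test hf ((hφ.continuous_fderiv (by simp)).clm_apply continuous_const)
    (hc.fderiv_apply ℝ v)

theorem integrable_inner_mul {Ω : Set Space} {g : Space → Space} {φ : Space → ℝ}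
    (hg : MemLp g 2 (volume.restrict Ω)) (hφ : ContDiff ℝ ∞ φ) (hc : HasCompactSupport φ)
    (v : Space) : Integrable (fun x => inner ℝ (g x) v * φ x) (volume.restrict Ω) :=
  integrable_mul_of_test (hg.inner_const v) hφ.continuous hc

/-- The Sobolev space `H¹(Ω)`, realised as the space of pairs (function, weak gradient) with the
norm `(‖f‖² + ‖∇f‖²)^{1/2}`. -/
def H1 (Ω : Set Space) : Submodule ℝ
    (WithLp 2 (Lp ℝ 2 (volume.restrict Ω) × Lp Space 2 (volume.restrict Ω))) where
  carrier := {p | HasH1Gradient Ω p.fst p.snd}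
  zero_mem' := by
    have h : HasH1Gradient Ω (fun _ => (0 : ℝ)) (fun _ => (0 : Space)) :=
      ⟨MemLp.zero', MemLp.zero', by simp⟩
    exact h.congr (Lp.coeFn_zero ℝ 2 _).symm (Lp.coeFn_zero Space 2 _).symm
  add_mem' {p q} hp hq := by
    have h : HasH1Gradient Ω (fun x => p.fst x + q.fst x) (fun x => p.snd x + q.snd x) := by
      refine ⟨hp.memLp.add hq.memLp, hp.memLp_gradient.add hq.memLp_gradient,
        fun φ h₁ h₂ h₃ v => ?_⟩
      simp only [add_mul, inner_add_left]
      rw [integral_add (integrable_mul_fderiv hp.memLp h₁ h₂ v)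
          (integrable_mul_fderiv hq.memLp h₁ h₂ v),
        integral_add (integrable_inner_mul hp.memLp_gradient h₁ h₂ v)
          (integrable_inner_mul hq.memLp_gradient h₁ h₂ v),
        hp.integral_eq φ h₁ h₂ h₃ v, hq.integral_eq φ h₁ h₂ h₃ v]
      ring
    exact h.congr (Lp.coeFn_add p.fst q.fst).symm (Lp.coeFn_add p.snd q.snd).symm
  smul_mem' a p hp := by
    have h : HasH1Gradient Ω (fun x => a * p.fst x) (fun x => a • p.snd x) := by
      refine ⟨hp.memLp.const_mul a, hp.memLp_gradient.const_smul a, fun φ h₁ h₂ h₃ v => ?_⟩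
      simp only [mul_assoc, real_inner_smul_left]
      rw [integral_const_mul, integral_const_mul, hp.integral_eq φ h₁ h₂ h₃ v]
      ring
    exact h.congr (Lp.coeFn_smul a p.fst).symm (Lp.coeFn_smul a p.snd).symm

/-- Lebesgue measure on `(0,T) × Ω`; space-time points are written `(t, x)`. -/
def spaceTime (Ω : Set Space) (T : ℝ) : Measure (ℝ × Space) :=
  (volume.restrict (Ioo 0 T)).prod (volume.restrict Ω)

/-- `v ∈ L²(0,T;H¹(Ω))` with spatial weak gradient `G`. -/
structure HasL2H1Gradient (Ω : Set Space) (T : ℝ) (v : ℝ → Space → ℝ)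
    (G : ℝ → Space → Space) : Prop where
  memLp : MemLp (fun p : ℝ × Space => v p.1 p.2) 2 (spaceTime Ω T)
  memLp_gradient : MemLp (fun p : ℝ × Space => G p.1 p.2) 2 (spaceTime Ω T)
  ae_gradient : ∀ᵐ t ∂(volume.restrict (Ioo 0 T)), HasH1Gradient Ω (v t) (G t)

/-- `v ∈ L²(0,T;H¹(Ω))`. -/
def MemL2H1 (Ω : Set Space) (T : ℝ) (v : ℝ → Space → ℝ) : Prop :=
  ∃ G : ℝ → Space → Space, HasL2H1Gradient Ω T v G

/-- `∂ₜv ∈ L²(0,T;H¹(Ω)*)`: the distributional time derivative of `v`, with `L²(Ω)` embedded in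
`H¹(Ω)*` through the `L²(Ω)` inner product, is a square integrable `H¹(Ω)*`-valued function `F`. -/
def HasL2DualTimeDeriv (Ω : Set Space) (T : ℝ) (v : ℝ → Space → ℝ) : Prop :=
  ∃ F : ℝ → StrongDual ℝ (H1 Ω), MemLp F 2 (volume.restrict (Ioo 0 T)) ∧
    ∀ (ψ : H1 Ω) (θ : ℝ → ℝ), ContDiff ℝ ∞ θ → HasCompactSupport θ → tsupport θ ⊆ Ioo 0 T →
      ∫ t in Ioo 0 T, deriv θ t * ∫ x in Ω, v t x * ψ.1.fst x = -∫ t in Ioo 0 T, θ t * F t ψ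

/-- `v ∈ C([0,T];L²(Ω))`. -/
def ContinuousInL2 (Ω : Set Space) (T : ℝ) (v : ℝ → Space → ℝ) : Prop :=
  ∀ t ∈ Icc 0 T, MemLp (v t) 2 (volume.restrict Ω) ∧
    Tendsto (fun s => eLpNorm (fun x => v s x - v t x) 2 (volume.restrict Ω))
      (𝓝[Icc 0 T] t) (𝓝 0)

/-- The test functions `C¹_c(Ω̄ × (0,T))`: (restrictions to `Ω̄` of) `C¹` functions with compact
support in time inside the open interval `(0,T)`, and no condition on `∂Ω`. -/
structure IsTestFunction (T : ℝ) (φ : ℝ × Space → ℝ) : Prop where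
  contDiff : ContDiff ℝ 1 φ
  hasCompactSupport : HasCompactSupport φ
  tsupport_subset : tsupport φ ⊆ Ioo 0 T ×ˢ univ

/-- Admissible binary coefficients: positive and symmetric off the diagonal. The diagonal values
play no role. -/
structure IsDiffusivity {n : ℕ} (D : Fin n → Fin n → ℝ) : Prop where
  pos : ∀ i j, i ≠ j → 0 < D i j
  symm : ∀ i j, D i j = D j i

/-- The matrix `A` of the friction system, for concentrations `a`:
`A i j = -√(a i * a j) / D i j` off the diagonal and `A i i = ∑_{k ≠ i} a k / D i k`. -/
def frictionMatrix {n : ℕ} (D : Fin n → Fin n → ℝ) (a : Fin n → ℝ) : Matrix (Fin n) (Fin n) ℝ :=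
  fun i j => if i = j then ∑ k ∈ Finset.univ.erase i, a k / D i k else -√(a i * a j) / D i j

/-- `m` solves, almost everywhere in `(0,T) × Ω`, the linear system
`-∑ⱼ A i j mⱼ = 2 ∇√cᵢ` subject to the constraint `∑ᵢ √cᵢ mᵢ = 0`, where `∇√cᵢ ∈ L²` is the
weak gradient of `√cᵢ`. -/
def SolvesFrictionSystem {n : ℕ} (Ω : Set Space) (T : ℝ) (D : Fin n → Fin n → ℝ)
    (c : Fin n → ℝ → Space → ℝ) (m : Fin n → ℝ → Space → Space) : Prop :=
  ∃ G : Fin n → ℝ → Space → Space,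
    (∀ i, HasL2H1Gradient Ω T (fun t x => √(c i t x)) (G i)) ∧
    ∀ᵐ p ∂(spaceTime Ω T),
      (∀ i, -∑ j, frictionMatrix D (fun k => c k p.1 p.2) i j • m j p.1 p.2
        = (2 : ℝ) • G i p.1 p.2) ∧
      ∑ i, √(c i p.1 p.2) • m i p.1 p.2 = 0

/-- Weak solutions `c` of the Maxwell–Stefan system on `(0,T) × Ω` with no-flux boundary condition
and initial datum `c₀`; `m i = √cᵢ uᵢ` are the associated rescaled velocities. -/
structure IsWeakSolution {n : ℕ} (Ω : Set Space) (T : ℝ) (D : Fin n → Fin n → ℝ)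
    (c₀ : Fin n → Space → ℝ) (c : Fin n → ℝ → Space → ℝ) (m : Fin n → ℝ → Space → Space) :
    Prop where
  memL2H1 : ∀ i, MemL2H1 Ω T (c i)
  timeDeriv : ∀ i, HasL2DualTimeDeriv Ω T (c i)
  measurable_m : ∀ i,
    AEStronglyMeasurable (fun p : ℝ × Space => m i p.1 p.2) (spaceTime Ω T)
  friction : SolvesFrictionSystem Ω T D c m
  weak_form : ∀ (i : Fin n) (φ : ℝ × Space → ℝ), IsTestFunction T φ →
    (∫ t in Ioo 0 T, ∫ x in Ω, c i t x * deriv (fun s => φ (s, x)) t) +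
      (∫ t in Ioo 0 T, ∫ x in Ω,
        inner ℝ (√(c i t x) • m i t x) (gradient (fun y => φ (t, y)) x)) = 0
  bounded : ∀ i, MemLp (fun p : ℝ × Space => c i p.1 p.2) ∞ (spaceTime Ω T)
  nonneg : ∀ i, ∀ᵐ p ∂(spaceTime Ω T), 0 ≤ c i p.1 p.2
  sum_eq_one : ∀ᵐ p ∂(spaceTime Ω T), ∑ i, c i p.1 p.2 = 1
  sqrt_memL2H1 : ∀ i, MemL2H1 Ω T (fun t x => √(c i t x))
  continuousInL2 : ∀ i, ContinuousInL2 Ω T (c i)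
  initial : ∀ i, c i 0 =ᵐ[volume.restrict Ω] c₀ i

/-- The diffusional velocity `u = m / √a` of a component of concentration `a`. Where `a = 0` it has
no meaning and is set to `0`. -/
def velocity (a : ℝ) (m : Space) : Space := (√a)⁻¹ • m

/-- The dissipation density `(cᵢ cⱼ / D i j) |uᵢ - uⱼ|²`. -/
def dissipation {n : ℕ} (D : Fin n → Fin n → ℝ) (c : Fin n → ℝ → Space → ℝ)
    (m : Fin n → ℝ → Space → Space) (i j : Fin n) (t : ℝ) (x : Space) : ℝ :=
  c i t x * c j t x / D i j *
    ‖velocity (c i t x) (m i t x) - velocity (c j t x) (m j t x)‖ ^ 2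

/-- The entropy density `a (ln a - 1)`, equal to `0` at `a = 0`. -/
def entropyDensity (a : ℝ) : ℝ := a * (Real.log a - 1)

/-- The entropy `H(c) = ∑ᵢ ∫_Ω cᵢ (ln cᵢ - 1) dx`. -/
def entropy {n : ℕ} (Ω : Set Space) (c : Fin n → Space → ℝ) : ℝ :=
  ∑ i, ∫ x in Ω, entropyDensity (c i x)

end

end MaxwellStefan

/-!
Testing the equation for `cᵢ` with `log (cᵢ + δ)`, a `C¹` function of `√cᵢ ∈ L²(0, T; H¹(Ω))` with
bounded derivative, and letting `δ → 0` turns the change of entropy into `2 ∑ᵢ ∫∫ mᵢ · ∇√cᵢ`, taken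
where `cᵢ > 0`; symmetrising the friction matrix turns this production into the dissipation. Three
points need care. The weak formulation only admits test functions that are `C¹` up to the boundary,
so `C¹` functions have to be dense in `H¹(Ω)`; they are as soon as every point of `closure Ω` is the
vertex of a truncated open cone of directions along which a whole neighbourhood of it enters `Ω`.
The time derivative is only weak, so the chain rule comes from convexity: tested against the
potential at a shifted time, the increment of the entropy is bounded below by a time correlation
that is continuous in the shift, and letting the shift tend to `0` from either side gives equality.
Finally, `δ → 0` requires `mᵢ ∈ L²`, which holds because the friction matrix is coercive on the
orthogonal complement of `(√c₁, …, √cₙ)`.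
-/

namespace MaxwellStefan

section LpTools

variable {α E F : Type*} [MeasurableSpace α] {μ : Measure α} [NormedAddCommGroup E]
  [NormedAddCommGroup F] {p : ℝ≥0∞}

theorem eLpNorm_rpow_toReal (hp : p ≠ 0) (hp' : p ≠ ⊤) (f : α → E) :
    eLpNorm f p μ ^ p.toReal = ∫⁻ x, ‖f x‖ₑ ^ p.toReal ∂μ := by
  lift p to NNReal using hp'
  exact eLpNorm_nnreal_pow_eq_lintegral (by simpa using hp)

theorem tendsto_eLpNorm_add_sub_add (hp : 1 ≤ p) {f g : ℕ → α → E} {f₀ g₀ : α → E}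
    (hf : ∀ k, AEStronglyMeasurable (f k) μ) (hf₀ : AEStronglyMeasurable f₀ μ)
    (hg : ∀ k, AEStronglyMeasurable (g k) μ) (hg₀ : AEStronglyMeasurable g₀ μ)
    (hff₀ : Tendsto (fun k => eLpNorm (f k - f₀) p μ) atTop (𝓝 0))
    (hgg₀ : Tendsto (fun k => eLpNorm (g k - g₀) p μ) atTop (𝓝 0)) :
    Tendsto (fun k => eLpNorm (f k + g k - (f₀ + g₀)) p μ) atTop (𝓝 0) := by
  refine tendsto_of_tendsto_of_tendsto_of_le_of_le tendsto_const_nhds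
    (by simpa using hff₀.add hgg₀) (fun _ => zero_le) fun k => ?_
  rw [add_sub_add_comm]
  exact eLpNorm_add_le ((hf k).sub hf₀) ((hg k).sub hg₀) hp

theorem tendsto_eLpNorm_zero_of_dominated (hp : p ≠ 0) (hp' : p ≠ ⊤) {f : ℕ → α → E} {g : α → F}
    (hf : ∀ k, AEStronglyMeasurable (f k) μ) (hg : MemLp g p μ)
    (hfg : ∀ k, ∀ᵐ x ∂μ, ‖f k x‖ ≤ ‖g x‖) (hlim : ∀ᵐ x ∂μ, Tendsto (f · x) atTop (𝓝 0)) :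
    Tendsto (fun k => eLpNorm (f k) p μ) atTop (𝓝 0) := by
  have hpos : 0 < p.toReal := ENNReal.toReal_pos hp hp'
  have hpow : Tendsto (fun k => eLpNorm (f k) p μ ^ p.toReal) atTop (𝓝 0) := by
    simp only [eLpNorm_rpow_toReal hp hp']
    rw [← lintegral_zero (μ := μ)]
    refine tendsto_lintegral_of_dominated_convergence' (fun x => ‖g x‖ₑ ^ p.toReal)
      (fun k => (hf k).enorm.pow_const _) (fun k => ?_) ?_ ?_
    · filter_upwards [hfg k] with x hx
      have := enorm_le_iff_norm_le.2 hx
      gcongr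
    · rw [← eLpNorm_rpow_toReal hp hp']
      exact (ENNReal.rpow_lt_top_of_nonneg hpos.le hg.2.ne).ne
    · filter_upwards [hlim] with x hx
      exact ((ENNReal.continuous_rpow_const.tendsto' _ _
        (by rw [enorm_zero, ENNReal.zero_rpow_of_pos hpos])).comp hx.enorm)
  refine ((ENNReal.continuous_rpow_const (y := p.toReal⁻¹)).tendsto' 0 0
    (ENNReal.zero_rpow_of_pos (inv_pos.2 hpos))).comp hpow |>.congr fun k => ?_
  exact ENNReal.rpow_rpow_inv hpos.ne' _

theorem tendsto_eLpNorm_smul_sub_smul [NormedSpace ℝ E] (hp : 1 ≤ p) (hp' : p ≠ ⊤)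
    {d : ℕ → α → ℝ} {d₀ : α → ℝ} {g : ℕ → α → E} {g₀ : α → E} {M : ℝ}
    (hd : ∀ k, AEStronglyMeasurable (d k) μ) (hM : ∀ k x, |d k x| ≤ M)
    (hlim : ∀ᵐ x ∂μ, Tendsto (d · x) atTop (𝓝 (d₀ x))) (hg : ∀ k, AEStronglyMeasurable (g k) μ)
    (hg₀ : MemLp g₀ p μ) (hgg₀ : Tendsto (fun k => eLpNorm (g k - g₀) p μ) atTop (𝓝 0)) :
    Tendsto (fun k => eLpNorm (d k • g k - d₀ • g₀) p μ) atTop (𝓝 0) := by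
  have hd₀ : AEStronglyMeasurable d₀ μ := aestronglyMeasurable_of_tendsto_ae atTop hd hlim
  have hcoeff : Tendsto (fun k => eLpNorm ((d k - d₀) • g₀) p μ) atTop (𝓝 0) := by
    refine tendsto_eLpNorm_zero_of_dominated (g := (2 * M) • g₀) (by positivity) hp'
      (fun k => ((hd k).sub hd₀).smul hg₀.1) (hg₀.const_smul _) (fun k => ?_) ?_
    · filter_upwards [hlim] with x hx
      have hM₀ : |d₀ x| ≤ M := le_of_tendsto hx.abs (Eventually.of_forall fun k => hM k x)
      rw [Pi.smul_apply', Pi.smul_apply, norm_smul, norm_smul, Pi.sub_apply, Real.norm_eq_abs,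
        Real.norm_eq_abs]
      refine mul_le_mul_of_nonneg_right ?_ (norm_nonneg _)
      linarith [abs_sub (d k x) (d₀ x), hM k x, le_abs_self (2 * M)]
    · filter_upwards [hlim] with x hx
      simpa using (hx.sub_const (d₀ x)).smul_const (g₀ x)
  have hdiff : Tendsto (fun k => ENNReal.ofReal M * eLpNorm (g k - g₀) p μ) atTop (𝓝 0) := by
    simpa using ENNReal.Tendsto.const_mul hgg₀ (Or.inr ENNReal.ofReal_ne_top)
  refine tendsto_of_tendsto_of_tendsto_of_le_of_le tendsto_const_nhds
    (by simpa using hdiff.add hcoeff) (fun _ => zero_le) fun k => ?_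
  have hsplit : d k • g k - d₀ • g₀ = d k • (g k - g₀) + (d k - d₀) • g₀ := by
    rw [smul_sub, sub_smul]
    abel
  rw [hsplit]
  refine (eLpNorm_add_le ((hd k).smul ((hg k).sub hg₀.1)) (((hd k).sub hd₀).smul hg₀.1) hp).trans ?_
  gcongr
  refine eLpNorm_le_mul_eLpNorm_of_ae_le_mul (Eventually.of_forall fun x => ?_) p
  rw [Pi.smul_apply', norm_smul]
  gcongr
  exact hM k x

end LpTools

section L2Inner

variable {α E : Type*} [MeasurableSpace α] {μ : Measure α} [NormedAddCommGroup E]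
  [InnerProductSpace ℝ E]

theorem integrable_inner {f g : α → E} (hf : MemLp f 2 μ) (hg : MemLp g 2 μ) :
    Integrable (fun x => inner ℝ (f x) (g x)) μ := by
  refine (L2.integrable_inner (𝕜 := ℝ) (hf.toLp f) (hg.toLp g)).congr ?_
  filter_upwards [hf.coeFn_toLp, hg.coeFn_toLp] with x hfx hgx
  rw [hfx, hgx]

theorem integral_inner_eq_inner_toLp {f g : α → E} (hf : MemLp f 2 μ) (hg : MemLp g 2 μ) :
    ∫ x, inner ℝ (f x) (g x) ∂μ = inner ℝ (hf.toLp f) (hg.toLp g) := by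
  rw [L2.inner_def]
  refine integral_congr_ae ?_
  filter_upwards [hf.coeFn_toLp, hg.coeFn_toLp] with x hfx hgx
  rw [hfx, hgx]

theorem tendsto_integral_inner {ι : Type*} {l : Filter ι} {f g₀ : α → E} {g : ι → α → E}
    (hf : MemLp f 2 μ) (hg : ∀ k, MemLp (g k) 2 μ) (hg₀ : MemLp g₀ 2 μ)
    (h : Tendsto (fun k => eLpNorm (g k - g₀) 2 μ) l (𝓝 0)) :
    Tendsto (fun k => ∫ x, inner ℝ (f x) (g k x) ∂μ) l (𝓝 (∫ x, inner ℝ (f x) (g₀ x) ∂μ)) := by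
  rw [integral_inner_eq_inner_toLp hf hg₀]
  simp only [integral_inner_eq_inner_toLp hf (hg _)]
  exact tendsto_const_nhds.inner ((Lp.tendsto_Lp_iff_tendsto_eLpNorm'' _ hg _ hg₀).2 h)

end L2Inner

section Jensen

variable {α E : Type*} [MeasurableSpace α] {μ : Measure α} [NormedAddCommGroup E]
  [NormedSpace ℝ E]

theorem lintegral_ofReal_eq_one {k : α → ℝ} (hk : Integrable k μ) (hk0 : ∀ x, 0 ≤ k x)
    (hk1 : ∫ x, k x ∂μ = 1) : ∫⁻ y, ENNReal.ofReal (k y) ∂μ = 1 := by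
  rw [← ofReal_integral_eq_lintegral_ofReal hk (Eventually.of_forall hk0), hk1, ENNReal.ofReal_one]

theorem enorm_integral_smul_rpow_le {p : ℝ≥0∞} (hp : 1 ≤ p) (hp' : p ≠ ⊤) {k : α → ℝ}
    (hk : Measurable k) (hk0 : ∀ x, 0 ≤ k x) (hk1 : ∫⁻ y, ENNReal.ofReal (k y) ∂μ = 1) {f : α → E}
    (hf : AEStronglyMeasurable f μ) :
    ‖∫ y, k y • f y ∂μ‖ₑ ^ p.toReal ≤ ∫⁻ y, ENNReal.ofReal (k y) * ‖f y‖ₑ ^ p.toReal ∂μ := by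
  set ν : Measure α := μ.withDensity fun y => ENNReal.ofReal (k y) with hν
  have hlint : ∀ h : α → ℝ≥0∞, ∫⁻ y, h y ∂ν = ∫⁻ y, ENNReal.ofReal (k y) * h y ∂μ := fun h =>
    lintegral_withDensity_eq_lintegral_mul_non_measurable _ hk.ennreal_ofReal
      (Eventually.of_forall fun _ => ENNReal.ofReal_lt_top) h
  have hprob : IsProbabilityMeasure ν :=
    ⟨by rw [hν, withDensity_apply _ MeasurableSet.univ, Measure.restrict_univ, hk1]⟩
  have hnorm : ‖∫ y, k y • f y ∂μ‖ₑ ≤ eLpNorm f 1 ν := by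
    rw [eLpNorm_one_eq_lintegral_enorm, hlint]
    refine (enorm_integral_le_lintegral_enorm _).trans (lintegral_congr fun y => ?_).le
    rw [enorm_smul, Real.enorm_eq_ofReal (hk0 y)]
  rw [← hlint, ← eLpNorm_rpow_toReal (by positivity) hp']
  gcongr
  exact hnorm.trans
    (eLpNorm_le_eLpNorm_of_exponent_le hp (hf.mono_ac (withDensity_absolutelyContinuous _ _)))

end Jensen

section Translation

variable {X E : Type*} [NormedAddCommGroup X] [NormedSpace ℝ X] [FiniteDimensional ℝ X]
  [MeasurableSpace X] [BorelSpace X]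
  {μ : Measure X} [μ.IsAddHaarMeasure] [NormedAddCommGroup E] {p : ℝ≥0∞} [Fact (1 ≤ p)]
  [Fact (p ≠ ⊤)]

theorem continuous_toLp_translate {f : X → E} (hf : MemLp f p μ) :
    Continuous fun y : X => (hf.comp_measurePreserving (measurePreserving_add_left μ y)).toLp
      (f ∘ (y + ·)) :=
  show Continuous fun y : X => DomAddAct.mk y +ᵥ hf.toLp f from
    DomAddAct.continuous_mk.vadd continuous_const

theorem tendsto_eLpNorm_translate_sub {f : X → E} (hf : MemLp f p μ) :
    Tendsto (fun y => eLpNorm (fun x => f (x - y) - f x) p μ) (𝓝 0) (𝓝 0) := by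
  have h := ((continuous_toLp_translate hf).comp continuous_neg).tendsto 0
  rw [tendsto_iff_edist_tendsto_0] at h
  refine h.congr fun y => ?_
  rw [Function.comp_apply, Function.comp_apply, Lp.edist_toLp_toLp]
  exact eLpNorm_congr_ae (Eventually.of_forall fun x => by simp [sub_eq_neg_add])

end Translation

section Mollification

variable {X E : Type*} [NormedAddCommGroup X] [NormedSpace ℝ X] [FiniteDimensional ℝ X]
  [MeasurableSpace X] [BorelSpace X] {μ : Measure X} [μ.IsAddHaarMeasure]
  [NormedAddCommGroup E] [NormedSpace ℝ E] [CompleteSpace E] {p : ℝ≥0∞}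

open scoped Convolution

theorem convolution_sub_eq_integral {k : X → ℝ} (hk : Continuous k) (hkc : HasCompactSupport k)
    (hk1 : ∫ x, k x ∂μ = 1) {f : X → E} (hf : LocallyIntegrable f μ) (x : X) :
    (k ⋆[ContinuousLinearMap.lsmul ℝ ℝ, μ] f) x - f x = ∫ y, k y • (f (x - y) - f x) ∂μ := by
  have hconv : Integrable (fun y => k y • f (x - y)) μ :=
    hkc.convolutionExists_left (ContinuousLinearMap.lsmul ℝ ℝ) hk hf x
  simp only [smul_sub]
  rw [integral_sub hconv ((hk.integrable_of_hasCompactSupport hkc).smul_const _),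
    integral_smul_const, hk1, one_smul]
  rfl

theorem eLpNorm_convolution_sub_le (hp : 1 ≤ p) (hp' : p ≠ ⊤) {k : X → ℝ} (hk : Continuous k)
    (hkc : HasCompactSupport k) (hk0 : ∀ x, 0 ≤ k x) (hk1 : ∫ x, k x ∂μ = 1) {f : X → E}
    (hf : MemLp f p μ) {ε : ℝ≥0∞}
    (hε : ∀ y, k y ≠ 0 → eLpNorm (fun x => f (x - y) - f x) p μ ≤ ε) :
    eLpNorm (fun x => (k ⋆[ContinuousLinearMap.lsmul ℝ ℝ, μ] f) x - f x) p μ ≤ ε := by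
  have hp0 : p ≠ 0 := by positivity
  have hkm : Measurable fun y => ENNReal.ofReal (k y) := hk.measurable.ennreal_ofReal
  have hkl := lintegral_ofReal_eq_one (hk.integrable_of_hasCompactSupport hkc) hk0 hk1
  have hmeas : AEMeasurable (Function.uncurry fun x y =>
      ENNReal.ofReal (k y) * ‖f (x - y) - f x‖ₑ ^ p.toReal) (μ.prod μ) :=
    (hkm.comp measurable_snd).aemeasurable.mul
      (((hf.1.comp_quasiMeasurePreserving (quasiMeasurePreserving_sub μ μ)).sub
        hf.1.comp_fst).enorm.pow_const _)
  have hjensen : ∀ x, ‖(k ⋆[ContinuousLinearMap.lsmul ℝ ℝ, μ] f) x - f x‖ₑ ^ p.toReal ≤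
      ∫⁻ y, ENNReal.ofReal (k y) * ‖f (x - y) - f x‖ₑ ^ p.toReal ∂μ := fun x => by
    rw [convolution_sub_eq_integral hk hkc hk1 (hf.locallyIntegrable hp)]
    exact enorm_integral_smul_rpow_le hp hp' hk.measurable hk0 hkl
      ((hf.1.comp_quasiMeasurePreserving (quasiMeasurePreserving_sub_left μ x)).sub
        aestronglyMeasurable_const)
  rw [← ENNReal.rpow_le_rpow_iff (ENNReal.toReal_pos hp0 hp'), eLpNorm_rpow_toReal hp0 hp']
  calc _ ≤ ∫⁻ x, ∫⁻ y, ENNReal.ofReal (k y) * ‖f (x - y) - f x‖ₑ ^ p.toReal ∂μ ∂μ :=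
        lintegral_mono hjensen
    _ = ∫⁻ y, ∫⁻ x, ENNReal.ofReal (k y) * ‖f (x - y) - f x‖ₑ ^ p.toReal ∂μ ∂μ :=
        lintegral_lintegral_swap hmeas
    _ ≤ ∫⁻ y, ENNReal.ofReal (k y) * ε ^ p.toReal ∂μ := by
        refine lintegral_mono fun y => ?_
        dsimp only
        rw [lintegral_const_mul' _ _ ENNReal.ofReal_ne_top, ← eLpNorm_rpow_toReal hp0 hp']
        by_cases hy : k y = 0
        · simp [hy]
        · gcongr
          exact hε y hy
    _ = ε ^ p.toReal := by rw [lintegral_mul_const _ hkm, hkl, one_mul]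

end Mollification

section Gradient

variable {E : Type*} [NormedAddCommGroup E] [InnerProductSpace ℝ E] [CompleteSpace E]
  {ψ φ : E → ℝ} {x : E}

theorem inner_gradient (ψ : E → ℝ) (x v : E) : inner ℝ (gradient ψ x) v = fderiv ℝ ψ x v := by
  simp [gradient]

theorem continuous_gradient (hψ : ContDiff ℝ 1 ψ) : Continuous (gradient ψ) :=
  (InnerProductSpace.toDual ℝ E).symm.continuous.comp (hψ.continuous_fderiv one_ne_zero)

theorem hasCompactSupport_gradient (hψ : HasCompactSupport ψ) : HasCompactSupport (gradient ψ) :=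
  (hψ.fderiv ℝ).comp_left (map_zero (InnerProductSpace.toDual ℝ E).symm)

theorem gradient_add (hψ : DifferentiableAt ℝ ψ x) (hφ : DifferentiableAt ℝ φ x) :
    gradient (ψ + φ) x = gradient ψ x + gradient φ x := by
  rw [gradient, gradient, gradient, fderiv_add hψ hφ, map_add]

theorem gradient_const_mul (b : ℝ) (hψ : DifferentiableAt ℝ ψ x) :
    gradient (fun y => b * ψ y) x = b • gradient ψ x :=
  ext_inner_right ℝ fun v => by
    rw [inner_gradient, real_inner_smul_left, inner_gradient, fderiv_const_mul hψ,
      smul_apply, smul_eq_mul]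

theorem gradient_comp {F : ℝ → ℝ} (hF : DifferentiableAt ℝ F (ψ x))
    (hψ : DifferentiableAt ℝ ψ x) : gradient (F ∘ ψ) x = deriv F (ψ x) • gradient ψ x :=
  ext_inner_right ℝ fun v => by
    rw [inner_gradient, real_inner_smul_left, inner_gradient,
      (hF.hasDerivAt.comp_hasFDerivAt x hψ.hasFDerivAt).fderiv, smul_apply, smul_eq_mul]

end Gradient

section C1Limit

variable {E : Type*} [NormedAddCommGroup E] [InnerProductSpace ℝ E] [FiniteDimensional ℝ E]
  [MeasurableSpace E] {μ : Measure E}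

/-- The pair `(w, G)` belongs to the closure in `L²(μ)` of the pairs `(ψ, ∇ψ)`, where `ψ` is a
compactly supported `C¹` function on the whole space. For `μ` the Lebesgue measure on a domain `Ω`
these are the weakly differentiable functions that can be approximated up to the boundary. -/
structure IsC1Limit (μ : Measure E) (w : E → ℝ) (G : E → E) : Prop where
  memLp : MemLp w 2 μ
  memLp_gradient : MemLp G 2 μ
  exists_seq : ∃ ψ : ℕ → E → ℝ, (∀ k, ContDiff ℝ 1 (ψ k)) ∧ (∀ k, HasCompactSupport (ψ k)) ∧
    Tendsto (fun k => eLpNorm (ψ k - w) 2 μ) atTop (𝓝 0) ∧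
    Tendsto (fun k => eLpNorm (gradient (ψ k) - G) 2 μ) atTop (𝓝 0)

variable {w w' : E → ℝ} {G G' : E → E}

namespace IsC1Limit

theorem zero : IsC1Limit μ (0 : E → ℝ) 0 where
  memLp := MemLp.zero
  memLp_gradient := MemLp.zero
  exists_seq := ⟨0, fun _ => contDiff_const, fun _ => HasCompactSupport.zero, by simp, by
    have : gradient (0 : E → ℝ) = 0 := funext fun x => gradient_const x 0
    simp [this]⟩

theorem congr (h : IsC1Limit μ w G) (hw : w =ᵐ[μ] w') (hG : G =ᵐ[μ] G') :
    IsC1Limit μ w' G' where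
  memLp := (memLp_congr_ae hw).1 h.memLp
  memLp_gradient := (memLp_congr_ae hG).1 h.memLp_gradient
  exists_seq := by
    obtain ⟨ψ, hψ, hψc, hψw, hψG⟩ := h.exists_seq
    refine ⟨ψ, hψ, hψc, hψw.congr fun k => ?_, hψG.congr fun k => ?_⟩
    · exact eLpNorm_congr_ae ((ae_eq_refl _).sub hw)
    · exact eLpNorm_congr_ae ((ae_eq_refl _).sub hG)

theorem of_forall_exists (hw : MemLp w 2 μ) (hG : MemLp G 2 μ)
    (h : ∀ ε : ℝ≥0∞, 0 < ε → ∃ ψ : E → ℝ, ContDiff ℝ 1 ψ ∧ HasCompactSupport ψ ∧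
      eLpNorm (ψ - w) 2 μ ≤ ε ∧ eLpNorm (gradient ψ - G) 2 μ ≤ ε) : IsC1Limit μ w G where
  memLp := hw
  memLp_gradient := hG
  exists_seq := by
    choose ψ hψ hψc hψw hψG using fun k : ℕ => h (k : ℝ≥0∞)⁻¹ (by simp)
    exact ⟨ψ, hψ, hψc,
      tendsto_of_tendsto_of_tendsto_of_le_of_le tendsto_const_nhds
        ENNReal.tendsto_inv_nat_nhds_zero (fun _ => zero_le) hψw,
      tendsto_of_tendsto_of_tendsto_of_le_of_le tendsto_const_nhds
        ENNReal.tendsto_inv_nat_nhds_zero (fun _ => zero_le) hψG⟩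

variable [BorelSpace E]

theorem add (h : IsC1Limit μ w G) (h' : IsC1Limit μ w' G') :
    IsC1Limit μ (w + w') (G + G') where
  memLp := h.memLp.add h'.memLp
  memLp_gradient := h.memLp_gradient.add h'.memLp_gradient
  exists_seq := by
    obtain ⟨ψ, hψ, hψc, hψw, hψG⟩ := h.exists_seq
    obtain ⟨φ, hφ, hφc, hφw, hφG⟩ := h'.exists_seq
    have hgrad : ∀ k, gradient (ψ k + φ k) = gradient (ψ k) + gradient (φ k) := fun k =>
      funext fun x => gradient_add ((hψ k).differentiable one_ne_zero x)
        ((hφ k).differentiable one_ne_zero x)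
    refine ⟨ψ + φ, fun k => (hψ k).add (hφ k), fun k => (hψc k).add (hφc k), ?_, ?_⟩
    · exact tendsto_eLpNorm_add_sub_add one_le_two (fun k => (hψ k).continuous.aestronglyMeasurable)
        h.memLp.1 (fun k => (hφ k).continuous.aestronglyMeasurable) h'.memLp.1 hψw hφw
    · simp only [Pi.add_apply, hgrad]
      exact tendsto_eLpNorm_add_sub_add one_le_two
        (fun k => (continuous_gradient (hψ k)).aestronglyMeasurable) h.memLp_gradient.1
        (fun k => (continuous_gradient (hφ k)).aestronglyMeasurable) h'.memLp_gradient.1 hψG hφG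

theorem sum {ι : Type*} {s : Finset ι} {w : ι → E → ℝ} {G : ι → E → E}
    (h : ∀ i ∈ s, IsC1Limit μ (w i) (G i)) : IsC1Limit μ (∑ i ∈ s, w i) (∑ i ∈ s, G i) := by
  classical
  induction s using Finset.induction_on with
  | empty => exact zero
  | insert a s ha ih =>
    rw [Finset.sum_insert ha, Finset.sum_insert ha]
    exact (h a (Finset.mem_insert_self a s)).add
      (ih fun i hi => h i (Finset.mem_insert_of_mem hi))

theorem exists_seq_tendsto_ae (h : IsC1Limit μ w G) :
    ∃ ψ : ℕ → E → ℝ, (∀ k, ContDiff ℝ 1 (ψ k)) ∧ (∀ k, HasCompactSupport (ψ k)) ∧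
      Tendsto (fun k => eLpNorm (ψ k - w) 2 μ) atTop (𝓝 0) ∧
      Tendsto (fun k => eLpNorm (gradient (ψ k) - G) 2 μ) atTop (𝓝 0) ∧
      ∀ᵐ x ∂μ, Tendsto (fun k => ψ k x) atTop (𝓝 (w x)) := by
  obtain ⟨ψ, hψ, hψc, hψw, hψG⟩ := h.exists_seq
  obtain ⟨ns, hns, hae⟩ := (tendstoInMeasure_of_tendsto_eLpNorm two_ne_zero
    (fun k => (hψ k).continuous.aestronglyMeasurable) h.memLp.1 hψw).exists_seq_tendsto_ae
  exact ⟨ψ ∘ ns, fun k => hψ _, fun k => hψc _, hψw.comp hns.tendsto_atTop,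
    hψG.comp hns.tendsto_atTop, hae⟩

theorem comp (h : IsC1Limit μ w G) {F : ℝ → ℝ} (hF : ContDiff ℝ 1 F) (hF0 : F 0 = 0) {M : ℝ}
    (hM : ∀ a, |deriv F a| ≤ M) : IsC1Limit μ (F ∘ w) ((deriv F ∘ w) • G) := by
  have hF' : Continuous (deriv F) := hF.continuous_deriv le_rfl
  have hFd : Differentiable ℝ F := hF.differentiable one_ne_zero
  have hlip : ∀ a b, ‖F a - F b‖ ≤ M * ‖a - b‖ := fun a b =>
    convex_univ.norm_image_sub_le_of_norm_deriv_le (fun x _ => hFd x) (fun x _ => hM x)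
      trivial trivial
  obtain ⟨ψ, hψ, hψc, hψw, hψG, hae⟩ := h.exists_seq_tendsto_ae
  have hgrad : ∀ k, gradient (F ∘ ψ k) = (deriv F ∘ ψ k) • gradient (ψ k) := fun k =>
    funext fun x => gradient_comp (hFd _) ((hψ k).differentiable one_ne_zero x)
  refine ⟨?_, ?_, fun k => F ∘ ψ k, fun k => hF.comp (hψ k), fun k => (hψc k).comp_left hF0,
    ?_, ?_⟩
  · refine h.memLp.of_le_mul (c := M) (hF.continuous.comp_aestronglyMeasurable h.memLp.1)
      (Eventually.of_forall fun x => ?_)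
    simpa [hF0] using hlip (w x) 0
  · refine h.memLp_gradient.of_le_mul (c := M)
      ((hF'.comp_aestronglyMeasurable h.memLp.1).smul h.memLp_gradient.1)
      (Eventually.of_forall fun x => ?_)
    rw [Pi.smul_apply', norm_smul]
    exact mul_le_mul_of_nonneg_right (hM _) (norm_nonneg _)
  · have hbound : Tendsto (fun k => ENNReal.ofReal M * eLpNorm (ψ k - w) 2 μ) atTop (𝓝 0) := by
      simpa using ENNReal.Tendsto.const_mul hψw (Or.inr ENNReal.ofReal_ne_top)
    exact tendsto_of_tendsto_of_tendsto_of_le_of_le tendsto_const_nhds hbound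
      (fun _ => zero_le) fun k =>
        eLpNorm_le_mul_eLpNorm_of_ae_le_mul (Eventually.of_forall fun x => hlip _ _) 2
  · simp only [hgrad]
    exact tendsto_eLpNorm_smul_sub_smul one_le_two ENNReal.ofNat_ne_top
      (fun k => (hF'.comp (hψ k).continuous).aestronglyMeasurable) (fun k x => hM _)
      (hae.mono fun x hx => (hF'.tendsto _).comp hx)
      (fun k => (continuous_gradient (hψ k)).aestronglyMeasurable) h.memLp_gradient hψG

end IsC1Limit

variable [BorelSpace E] [IsFiniteMeasureOnCompacts μ] {Ω : Set E}

theorem isC1Limit_const (hΩ : Bornology.IsBounded Ω) (a : ℝ) :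
    IsC1Limit (μ.restrict Ω) (fun _ => a) 0 := by
  obtain ⟨R, hΩR⟩ := hΩ.subset_ball_lt 0 0
  let η : ContDiffBump (0 : E) := ⟨R, R + 1, hΩR.1, lt_add_one R⟩
  have hη : ContDiff ℝ 1 (fun x => a * η x) := contDiff_const.mul η.contDiff
  have hηc : HasCompactSupport (fun x => a * η x) := η.hasCompactSupport.mul_left
  have hae : ∀ᵐ x ∂μ.restrict Ω, x ∈ Metric.ball (0 : E) R :=
    ae_mono (Measure.restrict_mono hΩR.2 le_rfl) (ae_restrict_mem measurableSet_ball)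
  have hone : ∀ x ∈ Metric.ball (0 : E) R, (fun x => a * η x) =ᶠ[𝓝 x] fun _ => a :=
    fun x hx => by
      filter_upwards [η.eventuallyEq_one_of_mem_ball hx] with y hy
      simp [hy]
  refine IsC1Limit.congr (w := fun x => a * η x) (G := gradient fun x => a * η x)
    ⟨(hη.continuous.memLp_of_hasCompactSupport hηc).restrict Ω,
      ((continuous_gradient hη).memLp_of_hasCompactSupport
        (hasCompactSupport_gradient hηc)).restrict Ω,
      fun _ x => a * η x, fun _ => hη, fun _ => hηc, by simp, by simp⟩ ?_ ?_
  · exact hae.mono fun x hx => (hone x hx).self_of_nhds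
  · exact hae.mono fun x hx => (hone x hx).gradient_eq.trans (gradient_const x a)

theorem IsC1Limit.comp_of_isBounded {w : E → ℝ} {G : E → E} (hΩ : Bornology.IsBounded Ω)
    (h : IsC1Limit (μ.restrict Ω) w G) {F : ℝ → ℝ} (hF : ContDiff ℝ 1 F) {M : ℝ}
    (hM : ∀ a, |deriv F a| ≤ M) : IsC1Limit (μ.restrict Ω) (F ∘ w) ((deriv F ∘ w) • G) := by
  have hcomp := (h.comp (F := fun a => F a - F 0) (hF.sub contDiff_const) (sub_self _)
    (M := M) (by simpa using hM)).add (isC1Limit_const hΩ (F 0))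
  refine hcomp.congr (ae_of_all _ fun x => ?_) (ae_of_all _ fun x => ?_)
  · simp
  · simp

end C1Limit

section InwardCone

variable {E : Type*} [NormedAddCommGroup E] [NormedSpace ℝ E]

/-- Interior cone condition at `x₀`: for some direction `v`, translating the part of `Ω` near `x₀`
by a small positive multiple of any vector close to `v` keeps it inside `Ω`. This is what
mollification up to the boundary needs; it holds at interior points (with `v = 0`) and at Lipschitz
boundary points. -/
def HasInwardConeAt (Ω : Set E) (x₀ : E) : Prop :=
  ∃ v : E, ∀ᶠ p : E × E × ℝ in 𝓝[Ω] x₀ ×ˢ 𝓝 v ×ˢ 𝓝[>] 0, p.1 + p.2.2 • p.2.1 ∈ Ω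

theorem tendsto_add_smul (x₀ v : E) :
    Tendsto (fun p : E × E × ℝ => p.1 + p.2.2 • p.2.1) (𝓝 x₀ ×ˢ 𝓝 v ×ˢ 𝓝[>] 0) (𝓝 x₀) := by
  have hcont : Continuous fun p : E × E × ℝ => p.1 + p.2.2 • p.2.1 := by fun_prop
  refine (hcont.tendsto' (x₀, v, 0) x₀ (by simp)).mono_left ?_
  rw [nhds_prod_eq, nhds_prod_eq]
  gcongr
  exact nhdsWithin_le_nhds

theorem hasInwardConeAt_of_mem_interior {Ω : Set E} {x₀ : E} (hx₀ : x₀ ∈ interior Ω) :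
    HasInwardConeAt Ω x₀ :=
  ⟨0, ((tendsto_add_smul x₀ 0).mono_left (by gcongr; exact nhdsWithin_le_nhds)).eventually
    (mem_interior_iff_mem_nhds.1 hx₀)⟩

theorem eventually_add_smul_lt {ρ : E → ℝ} {ℓ : E →L[ℝ] ℝ} {x₀ v : E}
    (hρ : HasStrictFDerivAt ρ ℓ x₀) (hv : ℓ v < 0) :
    ∀ᶠ p : E × E × ℝ in 𝓝 x₀ ×ˢ 𝓝 v ×ˢ 𝓝[>] 0, ρ (p.1 + p.2.2 • p.2.1) < ρ p.1 := by
  obtain ⟨η, hη, hηv⟩ : ∃ η > 0, η * (‖v‖ + 1) = -ℓ v / 2 :=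
    ⟨-ℓ v / 2 / (‖v‖ + 1), div_pos (by linarith) (by positivity), by field_simp⟩
  have hpair : Tendsto (fun p : E × E × ℝ => (p.1 + p.2.2 • p.2.1, p.1))
      (𝓝 x₀ ×ˢ 𝓝 v ×ˢ 𝓝[>] 0) (𝓝 (x₀, x₀)) := by
    rw [nhds_prod_eq]
    exact (tendsto_add_smul x₀ v).prodMk tendsto_fst
  have hu : Tendsto (fun p : E × E × ℝ => p.2.1) (𝓝 x₀ ×ˢ 𝓝 v ×ˢ 𝓝[>] 0) (𝓝 v) :=
    tendsto_fst.comp tendsto_snd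
  have hs : ∀ᶠ p : E × E × ℝ in 𝓝 x₀ ×ˢ 𝓝 v ×ˢ 𝓝[>] 0, 0 < p.2.2 :=
    (tendsto_snd.comp tendsto_snd).eventually self_mem_nhdsWithin
  filter_upwards [hpair.eventually (hρ.isLittleO.def hη), hs,
    hu.norm.eventually_lt_const (lt_add_one ‖v‖),
    ((ℓ.continuous.tendsto v).comp hu).eventually_lt_const (by linarith : ℓ v < ℓ v / 2)]
    with ⟨x, u, s⟩ happrox hs hnorm hlt
  simp only [add_sub_cancel_left, map_smul, norm_smul, Real.norm_of_nonneg hs.le, smul_eq_mul,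
    Function.comp_apply] at *
  have hslope := mul_lt_mul_of_pos_left hlt hs
  have herr : η * (s * ‖u‖) ≤ s * (-ℓ v / 2) := by
    rw [← hηv, mul_left_comm]
    gcongr
  linarith [le_of_abs_le happrox]

theorem hasInwardConeAt_of_hasStrictFDerivAt {Ω U : Set E} {ρ : E → ℝ} {ℓ : E →L[ℝ] ℝ} {x₀ : E}
    (hU : U ∈ 𝓝 x₀) (hρ : HasStrictFDerivAt ρ ℓ x₀) (hℓ : ℓ ≠ 0)
    (hΩ : ∀ x ∈ U, x ∈ Ω ↔ ρ x < 0) : HasInwardConeAt Ω x₀ := by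
  obtain ⟨v, hv⟩ : ∃ v, ℓ v < 0 := by
    obtain ⟨w, hw⟩ : ∃ w, ℓ w ≠ 0 := by simpa [DFunLike.ext_iff] using hℓ
    rcases hw.lt_or_gt with hw | hw
    exacts [⟨w, hw⟩, ⟨-w, by simpa using hw⟩]
  have hle : 𝓝[Ω] x₀ ×ˢ 𝓝 v ×ˢ 𝓝[>] (0 : ℝ) ≤ 𝓝 x₀ ×ˢ 𝓝 v ×ˢ 𝓝[>] 0 := by
    gcongr
    exact nhdsWithin_le_nhds
  have hx : Tendsto Prod.fst (𝓝[Ω] x₀ ×ˢ 𝓝 v ×ˢ 𝓝[>] (0 : ℝ)) (𝓝[Ω] x₀) := tendsto_fst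
  refine ⟨v, ?_⟩
  filter_upwards [hle (eventually_add_smul_lt hρ hv), hle ((tendsto_add_smul x₀ v).eventually hU),
    hx.eventually self_mem_nhdsWithin, hx.eventually (nhdsWithin_le_nhds hU)]
    with p hlt hpU hpΩ hU'
  exact (hΩ _ hpU).2 (lt_trans hlt ((hΩ _ hU').1 hpΩ))

theorem HasInwardConeAt.exists_pos {Ω : Set E} {x₀ : E} (h : HasInwardConeAt Ω x₀) :
    ∃ v : E, ∃ ε > 0, ∀ x ∈ Ω ∩ Metric.ball x₀ ε, ∀ u ∈ Metric.closedBall v ε, ∀ s ∈ Ioo 0 ε,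
      x + s • u ∈ Ω := by
  obtain ⟨v, hv⟩ := h
  obtain ⟨⟨r, ρ, σ⟩, ⟨hr, hρ, hσ⟩, hsub⟩ := (Metric.nhdsWithin_basis_ball.prod
    (Metric.nhds_basis_closedBall.prod (nhdsGT_basis (0 : ℝ)))).eventually_iff.1 hv
  refine ⟨v, min r (min ρ σ), lt_min hr (lt_min hρ hσ), fun x hx u hu s hs => ?_⟩
  exact hsub (x := (x, u, s)) ⟨⟨Metric.ball_subset_ball (min_le_left _ _) hx.2, hx.1⟩,
    Metric.closedBall_subset_closedBall ((min_le_right _ _).trans (min_le_left _ _)) hu,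
    hs.1, hs.2.trans_le ((min_le_right _ _).trans (min_le_right _ _))⟩

end InwardCone

theorem IsBoundedSmoothDomain.hasInwardConeAt {Ω : Set Space} (hΩ : IsBoundedSmoothDomain Ω)
    {x₀ : Space} (hx₀ : x₀ ∈ closure Ω) : HasInwardConeAt Ω x₀ := by
  rw [closure_eq_interior_union_frontier] at hx₀
  rcases hx₀ with hx₀ | hx₀
  · exact hasInwardConeAt_of_mem_interior hx₀
  · obtain ⟨U, ρ, hU, hxU, hρ, hd, hΩρ⟩ := hΩ.smooth_boundary x₀ hx₀
    exact hasInwardConeAt_of_hasStrictFDerivAt (hU.mem_nhds hxU)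
      ((hρ.contDiffAt (hU.mem_nhds hxU)).hasStrictFDerivAt (by simp)) hd hΩρ

section Mollifier

variable {E : Type*} [NormedAddCommGroup E]

/-- Smooth compactly supported probability densities with respect to `μ`: the kernels used to
regularise by convolution. -/
structure IsMollifier [NormedSpace ℝ E] [MeasurableSpace E] (μ : Measure E) (k : E → ℝ) :
    Prop where
  contDiff : ContDiff ℝ ∞ k
  hasCompactSupport : HasCompactSupport k
  nonneg : ∀ y, 0 ≤ k y
  integral_eq_one : ∫ y, k y ∂μ = 1

theorem exists_isMollifier [InnerProductSpace ℝ E] [FiniteDimensional ℝ E] [MeasurableSpace E]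
    [BorelSpace E] (μ : Measure E) [μ.IsAddHaarMeasure] (c : E) {r : ℝ} (hr : 0 < r) :
    ∃ k, IsMollifier μ k ∧ tsupport k = Metric.closedBall c r := by
  let b : ContDiffBump c := ⟨r / 2, r, half_pos hr, half_lt_self hr⟩
  exact ⟨b.normed μ, ⟨b.contDiff_normed, b.hasCompactSupport_normed, b.nonneg_normed,
    b.integral_normed⟩, b.tsupport_normed_eq⟩

-- Centring the kernel at `-s • v` makes `(k ⋆ g) x` average `g` over points `x + s • u` with `u`
-- close to `v`, which stay in `Ω` by the cone condition.
theorem HasInwardConeAt.exists_isMollifier [InnerProductSpace ℝ E] [FiniteDimensional ℝ E]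
    [MeasurableSpace E] [BorelSpace E] (μ : Measure E) [μ.IsAddHaarMeasure] {Ω : Set E} {x₀ : E}
    (h : HasInwardConeAt Ω x₀) :
    ∃ r > 0, ∀ δ > 0, ∃ k, IsMollifier μ k ∧ (∀ y ∈ tsupport k, ‖y‖ < δ) ∧
      ∀ x ∈ Ω, ∀ z ∈ Metric.ball x₀ r, x - z ∈ tsupport k → z ∈ Ω := by
  obtain ⟨v, ε, hε, hcone⟩ := h.exists_pos
  refine ⟨ε / 2, half_pos hε, fun δ hδ => ?_⟩
  have hvε : 0 < ‖v‖ + ε := by positivity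
  obtain ⟨s, hs0, hs⟩ : ∃ s, 0 < s ∧ s < min ε (min δ (ε / 2) / (‖v‖ + ε)) :=
    exists_between (by positivity)
  obtain ⟨hsε, hs⟩ := lt_min_iff.1 hs
  rw [lt_div_iff₀ hvε, lt_min_iff] at hs
  obtain ⟨k, hk, hks⟩ := MaxwellStefan.exists_isMollifier μ (-(s • v)) (mul_pos hs0 hε)
  have hnorm : ∀ y ∈ tsupport k, ‖y‖ ≤ s * (‖v‖ + ε) := fun y hy => by
    rw [hks, mem_closedBall_iff_norm, sub_neg_eq_add] at hy
    have htri := norm_sub_le (y + s • v) (s • v)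
    rw [add_sub_cancel_right, norm_smul, Real.norm_of_nonneg hs0.le] at htri
    linarith
  refine ⟨k, hk, fun y hy => (hnorm y hy).trans_lt hs.1, fun x hx z hz hxz => ?_⟩
  have hx' : x ∈ Metric.ball x₀ ε := by
    have hdist : dist x z < ε / 2 := by
      rw [dist_eq_norm]
      exact (hnorm _ hxz).trans_lt hs.2
    rw [Metric.mem_ball] at hz ⊢
    linarith [dist_triangle x z x₀]
  have hu : s⁻¹ • (z - x) ∈ Metric.closedBall v ε := by
    rw [hks, mem_closedBall_iff_norm, sub_neg_eq_add] at hxz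
    have hsub : x - z + s • v = -(s • (s⁻¹ • (z - x) - v)) := by
      rw [smul_sub, smul_inv_smul₀ hs0.ne']
      abel
    rw [hsub, norm_neg, norm_smul, Real.norm_of_nonneg hs0.le] at hxz
    exact mem_closedBall_iff_norm.2 (le_of_mul_le_mul_left hxz hs0)
  have hmem := hcone x ⟨hx, hx'⟩ _ hu s ⟨hs0, hsε⟩
  rwa [smul_inv_smul₀ hs0.ne', add_sub_cancel] at hmem

end Mollifier

section ConvolutionGradient

open scoped Convolution

variable {E : Type*} [NormedAddCommGroup E] [InnerProductSpace ℝ E] [FiniteDimensional ℝ E]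
  [MeasurableSpace E] [BorelSpace E] {μ : Measure E} [μ.IsAddHaarMeasure]
  {k g : E → ℝ} {H : E → E}

theorem fderiv_convolution_apply (hk : ContDiff ℝ 1 k) (hkc : HasCompactSupport k)
    (hg : LocallyIntegrable g μ) (x v : E) :
    fderiv ℝ (k ⋆[ContinuousLinearMap.lsmul ℝ ℝ, μ] g) x v =
      ∫ z, fderiv ℝ k (x - z) v * g z ∂μ := by
  rw [(hkc.hasFDerivAt_convolution_left (ContinuousLinearMap.lsmul ℝ ℝ) hk hg x).fderiv,
    convolution, ContinuousLinearMap.integral_apply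
      ((hkc.fderiv ℝ).convolutionExists_left _ (hk.continuous_fderiv one_ne_zero)
        hg x).integrable,
    ← integral_sub_left_eq_self _ _ x]
  simp

theorem inner_convolution (hk : Continuous k) (hkc : HasCompactSupport k)
    (hH : LocallyIntegrable H μ) (x v : E) :
    inner ℝ ((k ⋆[ContinuousLinearMap.lsmul ℝ ℝ, μ] H) x) v =
      ∫ z, inner ℝ (H z) v * k (x - z) ∂μ := by
  have hint : Integrable (fun z => k z • H (x - z)) μ :=
    hkc.convolutionExists_left (ContinuousLinearMap.lsmul ℝ ℝ) hk hH x
  rw [real_inner_comm, convolution]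
  simp only [ContinuousLinearMap.lsmul_apply]
  rw [← integral_inner hint, ← integral_sub_left_eq_self _ _ x]
  simp [inner_smul_right, real_inner_comm, mul_comm]

theorem gradient_convolution_eq (hk : ContDiff ℝ 1 k) (hkc : HasCompactSupport k)
    (hg : LocallyIntegrable g μ) (hH : LocallyIntegrable H μ) {x : E}
    (hweak : ∀ v, ∫ z, g z * fderiv ℝ (fun y => k (x - y)) z v ∂μ =
      -∫ z, inner ℝ (H z) v * k (x - z) ∂μ) :
    gradient (k ⋆[ContinuousLinearMap.lsmul ℝ ℝ, μ] g) x =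
      (k ⋆[ContinuousLinearMap.lsmul ℝ ℝ, μ] H) x := by
  refine ext_inner_right ℝ fun v => ?_
  have hreflect : ∀ z, fderiv ℝ (fun y => k (x - y)) z v = -fderiv ℝ k (x - z) v := fun z => by
    have hcomp : HasFDerivAt (fun y => k (x - y)) _ z :=
      (hk.differentiable one_ne_zero (x - z)).hasFDerivAt.comp z ((hasFDerivAt_id z).const_sub x)
    simp [hcomp.fderiv]
  have hv := hweak v
  simp only [hreflect, mul_neg, integral_neg, neg_inj] at hv
  rw [inner_gradient, fderiv_convolution_apply hk hkc hg, inner_convolution hk.continuous hkc hH,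
    ← hv]
  simp only [mul_comm]

theorem isC1Limit_of_gradient_convolution {Ω : Set E} (hg : MemLp g 2 μ)
    (hgc : HasCompactSupport g) (hH : MemLp H 2 μ) (hΩ : MeasurableSet Ω)
    (hconv : ∀ δ > 0, ∃ k, IsMollifier μ k ∧ (∀ y ∈ tsupport k, ‖y‖ < δ) ∧
      ∀ x ∈ Ω, gradient (k ⋆[ContinuousLinearMap.lsmul ℝ ℝ, μ] g) x =
        (k ⋆[ContinuousLinearMap.lsmul ℝ ℝ, μ] H) x) :
    IsC1Limit (μ.restrict Ω) g H := by
  have : Fact ((2 : ℝ≥0∞) ≠ ⊤) := ⟨ENNReal.ofNat_ne_top⟩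
  refine .of_forall_exists (hg.restrict Ω) (hH.restrict Ω) fun ε hε => ?_
  obtain ⟨δ, hδ, hball⟩ := Metric.eventually_nhds_iff.1
    (((tendsto_eLpNorm_translate_sub hg).eventually (ge_mem_nhds hε)).and
      ((tendsto_eLpNorm_translate_sub hH).eventually (ge_mem_nhds hε)))
  obtain ⟨k, hk, hkδ, hgrad⟩ := hconv δ hδ
  have hnear : ∀ y, k y ≠ 0 → eLpNorm (fun x => g (x - y) - g x) 2 μ ≤ ε ∧
      eLpNorm (fun x => H (x - y) - H x) 2 μ ≤ ε := fun y hy =>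
    hball (by simpa only [dist_zero_right] using hkδ y (subset_tsupport k hy))
  have hgk := eLpNorm_convolution_sub_le one_le_two ENNReal.ofNat_ne_top hk.contDiff.continuous
    hk.hasCompactSupport hk.nonneg hk.integral_eq_one hg fun y hy => (hnear y hy).1
  have hHk := eLpNorm_convolution_sub_le one_le_two ENNReal.ofNat_ne_top hk.contDiff.continuous
    hk.hasCompactSupport hk.nonneg hk.integral_eq_one hH fun y hy => (hnear y hy).2
  refine ⟨k ⋆[ContinuousLinearMap.lsmul ℝ ℝ, μ] g, ?_, hk.hasCompactSupport.convolution _ hgc,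
    (eLpNorm_restrict_le _ _ _ _).trans hgk, ?_⟩
  · exact hk.hasCompactSupport.contDiff_convolution_left _ (hk.contDiff.of_le (by simp))
      (hg.locallyIntegrable one_le_two)
  · refine (le_of_eq_of_le (eLpNorm_congr_ae ?_) (eLpNorm_restrict_le _ _ μ Ω)).trans hHk
    filter_upwards [ae_restrict_mem hΩ] with x hx
    rw [Pi.sub_apply, hgrad x hx]

end ConvolutionGradient

section Density

open scoped Convolution

variable {Ω : Set Space} {f χ : Space → ℝ} {G : Space → Space}

theorem HasH1Gradient.integral_mul_cutoff_mul_fderiv (h : HasH1Gradient Ω f G)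
    (hχ : ContDiff ℝ ∞ χ) (hχc : HasCompactSupport χ) {φ : Space → ℝ} (hφ : ContDiff ℝ ∞ φ)
    (hsub : tsupport (χ * φ) ⊆ Ω) (v : Space) :
    ∫ z in Ω, f z * χ z * fderiv ℝ φ z v =
      -∫ z in Ω, inner ℝ (χ z • G z + f z • gradient χ z) v * φ z := by
  have hweak := h.integral_eq (χ * φ) (hχ.mul hφ) hχc.mul_right hsub v
  have hprod : ∀ z, fderiv ℝ (χ * φ) z v = χ z * fderiv ℝ φ z v + φ z * fderiv ℝ χ z v :=
    fun z => by
      rw [fderiv_mul (hχ.differentiable (by simp) z) (hφ.differentiable (by simp) z)]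
      simp
  have hφ' : Integrable (fun z => f z * (χ z * fderiv ℝ φ z v)) (volume.restrict Ω) :=
    integrable_mul_of_test h.memLp (hχ.continuous.mul
      ((hφ.continuous_fderiv (by simp)).clm_apply continuous_const)) hχc.mul_right
  have hχ' : Integrable (fun z => f z * (φ z * fderiv ℝ χ z v)) (volume.restrict Ω) :=
    integrable_mul_of_test h.memLp (hφ.continuous.mul
      ((hχ.continuous_fderiv (by simp)).clm_apply continuous_const)) (hχc.fderiv_apply ℝ v).mul_left
  have hG : Integrable (fun z => inner ℝ (G z) v * (χ z * φ z)) (volume.restrict Ω) :=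
    integrable_mul_of_test (h.memLp_gradient.inner_const v) (hχ.continuous.mul hφ.continuous)
      hχc.mul_right
  have hsplit : ∀ z, inner ℝ (χ z • G z + f z • gradient χ z) v * φ z =
      inner ℝ (G z) v * (χ z * φ z) + f z * (φ z * fderiv ℝ χ z v) := fun z => by
    rw [inner_add_left, real_inner_smul_left, real_inner_smul_left, inner_gradient]
    ring
  simp only [hprod, mul_add, Pi.mul_apply] at hweak
  rw [integral_add hφ' hχ'] at hweak
  simp only [hsplit, mul_assoc]
  rw [integral_add hG hχ']
  linarith

theorem HasH1Gradient.memLp_mul_cutoff (h : HasH1Gradient Ω f G) (hχ : Continuous χ)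
    (hχc : HasCompactSupport χ) : MemLp (fun z => f z * χ z) 2 (volume.restrict Ω) :=
  ((hχ.memLp_of_hasCompactSupport hχc).restrict Ω).mul (q := ⊤) h.memLp

theorem HasH1Gradient.memLp_gradient_cutoff (h : HasH1Gradient Ω f G) (hχ : ContDiff ℝ 1 χ)
    (hχc : HasCompactSupport χ) :
    MemLp (fun z => χ z • G z + f z • gradient χ z) 2 (volume.restrict Ω) :=
  (h.memLp_gradient.smul (p := ⊤)
      ((hχ.continuous.memLp_of_hasCompactSupport hχc).restrict Ω)).add
    ((((continuous_gradient hχ).memLp_of_hasCompactSupport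
      (hasCompactSupport_gradient hχc)).restrict Ω).smul (q := ⊤) h.memLp)

theorem HasH1Gradient.gradient_convolution_cutoff (h : HasH1Gradient Ω f G)
    (hΩ : MeasurableSet Ω) (hχ : ContDiff ℝ ∞ χ) (hχc : HasCompactSupport χ) {k : Space → ℝ}
    (hk : ContDiff ℝ ∞ k) (hkc : HasCompactSupport k) {x : Space}
    (hsub : tsupport (χ * fun z => k (x - z)) ⊆ Ω) :
    gradient (k ⋆[ContinuousLinearMap.lsmul ℝ ℝ, volume] Ω.indicator fun z => f z * χ z) x =
      (k ⋆[ContinuousLinearMap.lsmul ℝ ℝ, volume]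
        Ω.indicator fun z => χ z • G z + f z • gradient χ z) x := by
  have hg := (memLp_indicator_iff_restrict hΩ).2 (h.memLp_mul_cutoff hχ.continuous hχc)
  have hH := (memLp_indicator_iff_restrict hΩ).2
    (h.memLp_gradient_cutoff (hχ.of_le (by simp)) hχc)
  refine gradient_convolution_eq (hk.of_le (by simp)) hkc (hg.locallyIntegrable one_le_two)
    (hH.locallyIntegrable one_le_two) fun v => ?_
  have hleft : ∀ z, Ω.indicator (fun z => f z * χ z) z * fderiv ℝ (fun y => k (x - y)) z v =
      Ω.indicator (fun z => f z * χ z * fderiv ℝ (fun y => k (x - y)) z v) z := fun z =>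
    by by_cases hz : z ∈ Ω <;> simp [hz]
  have hright : ∀ z,
      inner ℝ (Ω.indicator (fun z => χ z • G z + f z • gradient χ z) z) v * k (x - z) =
      Ω.indicator (fun z => inner ℝ (χ z • G z + f z • gradient χ z) v * k (x - z)) z :=
    fun z => by by_cases hz : z ∈ Ω <;> simp [hz]
  simp only [hleft, hright]
  rw [integral_indicator hΩ, integral_indicator hΩ]
  exact h.integral_mul_cutoff_mul_fderiv hχ hχc (hk.comp (contDiff_const.sub contDiff_id)) hsub v

theorem HasInwardConeAt.exists_isC1Limit_cutoff (hΩ : MeasurableSet Ω) {x₀ : Space}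
    (hx₀ : HasInwardConeAt Ω x₀) :
    ∃ r > 0, ∀ {f : Space → ℝ} {G : Space → Space}, HasH1Gradient Ω f G → ∀ {χ : Space → ℝ},
      ContDiff ℝ ∞ χ → HasCompactSupport χ → tsupport χ ⊆ Metric.ball x₀ r →
      IsC1Limit (volume.restrict Ω) (fun z => f z * χ z)
        (fun z => χ z • G z + f z • gradient χ z) := by
  obtain ⟨r, hr, hmol⟩ := hx₀.exists_isMollifier volume
  refine ⟨r, hr, fun {f G} h χ hχ hχc hχr => ?_⟩
  have hg := (memLp_indicator_iff_restrict hΩ).2 (h.memLp_mul_cutoff hχ.continuous hχc)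
  have hH := (memLp_indicator_iff_restrict hΩ).2
    (h.memLp_gradient_cutoff (hχ.of_le (by simp)) hχc)
  have hgc : HasCompactSupport (Ω.indicator fun z => f z * χ z) :=
    hχc.mul_left.mono (support_indicator.trans_subset inter_subset_right)
  refine (isC1Limit_of_gradient_convolution hg hgc hH hΩ fun δ hδ => ?_).congr
    (indicator_ae_eq_restrict hΩ) (indicator_ae_eq_restrict hΩ)
  obtain ⟨k, hk, hkδ, hkΩ⟩ := hmol δ hδ
  refine ⟨k, hk, hkδ, fun x hx => h.gradient_convolution_cutoff hΩ hχ hχc hk.contDiff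
    hk.hasCompactSupport fun z hz => hkΩ x hx z (hχr (tsupport_mul_subset_left hz)) ?_⟩
  exact tsupport_comp_subset_preimage k (continuous_const.sub continuous_id)
    (tsupport_mul_subset_right hz)

open scoped Manifold in
theorem exists_partitionOfUnity_cutoff {K : Set Space} (hK : IsCompact K) {r : Space → ℝ}
    (hr : ∀ x ∈ K, 0 < r x) :
    ∃ (t : Finset Space) (p : t → Space → ℝ), (∀ i : t, (i : Space) ∈ K) ∧
      (∀ i, ContDiff ℝ ∞ (p i)) ∧ (∀ i, HasCompactSupport (p i)) ∧
      (∀ i : t, tsupport (p i) ⊆ Metric.ball i (r i)) ∧ ∀ x ∈ K, ∑ i, p i x = 1 := by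
  obtain ⟨t, htK, hcov⟩ := hK.elim_nhds_subcover (fun x => Metric.ball x (r x))
    fun x hx => Metric.ball_mem_nhds x (hr x hx)
  obtain ⟨p, hp⟩ := SmoothPartitionOfUnity.exists_isSubordinate 𝓘(ℝ, Space) hK.isClosed
    (fun i : t => Metric.ball (i : Space) (r i)) (fun i => Metric.isOpen_ball)
    (fun x hx => by simpa using hcov hx)
  refine ⟨t, fun i => p i, fun i => htK i i.2, fun i => (p i).contMDiff.contDiff, fun i =>
    Metric.isCompact_of_isClosed_isBounded (isClosed_tsupport _)
      (Metric.isBounded_ball.subset (hp i)), hp, fun x hx => ?_⟩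
  rw [← finsum_eq_sum_of_fintype]
  exact p.sum_eq_one hx

theorem sum_gradient_eq_zero {ι : Type*} [Fintype ι] {p : ι → Space → ℝ} (hΩ : IsOpen Ω)
    (hp : ∀ i, Differentiable ℝ (p i)) (hsum : ∀ x ∈ Ω, ∑ i, p i x = 1) {x : Space}
    (hx : x ∈ Ω) : ∑ i, gradient (p i) x = 0 := by
  have hone : (fun y => ∑ i, p i y) =ᶠ[𝓝 x] fun _ => (1 : ℝ) := by
    filter_upwards [hΩ.mem_nhds hx] with y hy using hsum y hy
  refine ext_inner_right ℝ fun v => ?_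
  have hfderiv := hone.fderiv_eq (𝕜 := ℝ)
  rw [fderiv_fun_sum fun i _ => hp i x, fderiv_fun_const] at hfderiv
  simpa [sum_inner, inner_gradient] using DFunLike.congr_fun hfderiv v

theorem HasH1Gradient.isC1Limit (h : HasH1Gradient Ω f G) (hΩ : IsOpen Ω)
    (hΩb : Bornology.IsBounded Ω) (hcone : ∀ x₀ ∈ closure Ω, HasInwardConeAt Ω x₀) :
    IsC1Limit (volume.restrict Ω) f G := by
  choose! r hr hcutoff using fun x₀ hx₀ => (hcone x₀ hx₀).exists_isC1Limit_cutoff hΩ.measurableSet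
  obtain ⟨t, p, htΩ, hp, hpc, hpr, hsum⟩ := exists_partitionOfUnity_cutoff hΩb.isCompact_closure hr
  have hlim := IsC1Limit.sum fun (i : t) (_ : i ∈ Finset.univ) =>
    hcutoff i (htΩ i) h (hp i) (hpc i) (hpr i)
  refine hlim.congr ?_ ?_
  · filter_upwards [ae_restrict_mem hΩ.measurableSet] with x hx
    rw [Finset.sum_apply, ← Finset.mul_sum, hsum x (subset_closure hx), mul_one]
  · filter_upwards [ae_restrict_mem hΩ.measurableSet] with x hx
    rw [Finset.sum_apply, Finset.sum_add_distrib, ← Finset.sum_smul, ← Finset.smul_sum,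
      hsum x (subset_closure hx), one_smul, sum_gradient_eq_zero hΩ
        (fun i => (hp i).differentiable (by simp)) (fun y hy => hsum y (subset_closure hy)) hx,
      smul_zero, add_zero]

end Density

section WeakTimeDerivative

variable {a b : ℝ}

theorem integrableOn_Ioo_mul {g U : ℝ → ℝ} (hg : Continuous g) (hU : ContinuousOn U (Icc a b)) :
    IntegrableOn (fun t => g t * U t) (Ioo a b) :=
  ((hg.continuousOn.mul hU).integrableOn_Icc).mono_set Ioo_subset_Icc_self

theorem exists_contDiff_deriv_eq_of_integral_eq_zero {g : ℝ → ℝ} (hg : Continuous g)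
    (hgc : HasCompactSupport g) (hsub : tsupport g ⊆ Ioo a b) (h0 : ∫ t, g t = 0) :
    ∃ θ : ℝ → ℝ, ContDiff ℝ 1 θ ∧ HasCompactSupport θ ∧ tsupport θ ⊆ Ioo a b ∧ deriv θ = g := by
  have hderiv : deriv (fun t => ∫ r in a..t, g r) = g := funext fun t => hg.deriv_integral g a t
  have hC1 : ContDiff ℝ 1 (fun t => ∫ r in a..t, g r) :=
    contDiff_one_iff_deriv.2
      ⟨fun t => (intervalIntegral.integral_hasDerivAt_right (hg.intervalIntegrable _ _)
        hg.aestronglyMeasurable.stronglyMeasurableAtFilter hg.continuousAt).differentiableAt,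
        by rwa [hderiv]⟩
  rcases (tsupport g).eq_empty_or_nonempty with hempty | hne
  · obtain rfl : g = 0 := tsupport_eq_empty_iff.1 hempty
    exact ⟨0, contDiff_const, .zero, by simp, by simp⟩
  obtain ⟨s, hs, hs_le⟩ := hgc.isCompact.exists_isLeast hne
  obtain ⟨t, ht, h_le⟩ := hgc.isCompact.exists_isGreatest hne
  have hzero : ∀ r ∉ Icc s t, ∫ q in a..r, g q = 0 := by
    intro r hr
    rcases lt_or_ge r s with hrs | hsr
    · refine intervalIntegral.integral_zero_ae (.of_forall fun q hq => ?_)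
      refine image_eq_zero_of_notMem_tsupport fun hq' => (hs_le hq').not_gt ?_
      exact (uIoc_subset_uIcc hq).2.trans_lt (max_lt (hsub hs).1 hrs)
    · have htr : t < r := lt_of_not_ge fun h => hr ⟨hsr, h⟩
      rw [intervalIntegral.integral_eq_integral_of_support_subset fun q hq => ?_, h0]
      exact ⟨(hsub (subset_tsupport g hq)).1, (h_le (subset_tsupport g hq)).trans htr.le⟩
  refine ⟨_, hC1, .intro isCompact_Icc hzero, ?_, hderiv⟩
  refine (closure_minimal ?_ isClosed_Icc).trans (Icc_subset_Ioo (hsub hs).1 (hsub ht).2)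
  exact fun r hr => by_contra fun hr' => hr (hzero r hr')

/- A test function `g` differs from the derivative of a test function by `(∫ g) • η`, where `η` is
a fixed test function of integral one. -/
theorem integral_mul_eq_of_integral_deriv_mul_eq_zero {U : ℝ → ℝ} (hU : ContinuousOn U (Icc a b))
    (h : ∀ θ : ℝ → ℝ, ContDiff ℝ 1 θ → HasCompactSupport θ → tsupport θ ⊆ Ioo a b →
      ∫ t in Ioo a b, deriv θ t * U t = 0)
    {η : ℝ → ℝ} (hη : IsMollifier volume η) (hηsub : tsupport η ⊆ Ioo a b)
    {g : ℝ → ℝ} (hg : Continuous g) (hgc : HasCompactSupport g) (hgsub : tsupport g ⊆ Ioo a b) :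
    ∫ t in Ioo a b, g t * U t = (∫ t, g t) * ∫ t in Ioo a b, η t * U t := by
  have hη' := hη.contDiff.continuous
  have hmean : ∫ t, (g t - (∫ r, g r) * η t) = 0 := by
    rw [integral_sub (hg.integrable_of_hasCompactSupport hgc)
      ((hη'.integrable_of_hasCompactSupport hη.hasCompactSupport).const_mul _),
      integral_const_mul, hη.integral_eq_one, mul_one, sub_self]
  have hsupp : tsupport (fun t => g t - (∫ r, g r) * η t) ⊆ tsupport g ∪ tsupport η :=
    (tsupport_sub g _).trans (union_subset_union_right _ (tsupport_mul_subset_right))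
  have hcompact : HasCompactSupport fun t => g t - (∫ r, g r) * η t :=
    (hgc.isCompact.union hη.hasCompactSupport.isCompact).of_isClosed_subset
      (isClosed_tsupport _) hsupp
  obtain ⟨θ, hθ, hθc, hθsub, hθ'⟩ := exists_contDiff_deriv_eq_of_integral_eq_zero
    (hg.sub (hη'.const_mul _)) hcompact (hsupp.trans (union_subset hgsub hηsub)) hmean
  have hzero := h θ hθ hθc hθsub
  simp only [hθ', Pi.sub_apply, sub_mul, mul_assoc] at hzero
  rwa [integral_sub (integrableOn_Ioo_mul hg hU) ((integrableOn_Ioo_mul hη' hU).const_mul _),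
    integral_const_mul, sub_eq_zero] at hzero

theorem exists_eqOn_const_of_integral_deriv_mul_eq_zero (hab : a < b) {U : ℝ → ℝ}
    (hU : ContinuousOn U (Icc a b))
    (h : ∀ θ : ℝ → ℝ, ContDiff ℝ 1 θ → HasCompactSupport θ → tsupport θ ⊆ Ioo a b →
      ∫ t in Ioo a b, deriv θ t * U t = 0) :
    ∃ C, EqOn U (fun _ => C) (Icc a b) := by
  obtain ⟨η, hη, hηsupp⟩ := exists_isMollifier (volume : Measure ℝ) ((a + b) / 2)
    (r := (b - a) / 4) (by linarith)
  have hηsub : tsupport η ⊆ Ioo a b := by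
    rw [hηsupp, Real.closedBall_eq_Icc]
    exact Icc_subset_Ioo (by linarith) (by linarith)
  set C : ℝ := ∫ t in Ioo a b, η t * U t
  have hcont : ContinuousOn (fun t => U t - C) (Ioo a b) :=
    (hU.sub continuousOn_const).mono Ioo_subset_Icc_self
  have hae : ∀ᵐ t, t ∈ Ioo a b → U t - C = 0 := by
    refine isOpen_Ioo.ae_eq_zero_of_integral_contDiff_smul_eq_zero
      (hcont.locallyIntegrableOn measurableSet_Ioo) fun g hg hgc hgsub => ?_
    have hvanish : ∀ t ∉ Ioo a b, g t = 0 := fun t ht =>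
      image_eq_zero_of_notMem_tsupport fun ht' => ht (hgsub ht')
    have hgint : Integrable g := hg.continuous.integrable_of_hasCompactSupport hgc
    rw [← setIntegral_eq_integral_of_forall_compl_eq_zero (s := Ioo a b)
      fun t ht => by rw [hvanish t ht, zero_smul]]
    simp only [smul_eq_mul, mul_sub]
    rw [integral_sub (integrableOn_Ioo_mul hg.continuous hU) (hgint.mul_const C).integrableOn,
      integral_mul_const, setIntegral_eq_integral_of_forall_compl_eq_zero hvanish, sub_eq_zero]
    exact integral_mul_eq_of_integral_deriv_mul_eq_zero hU h hη hηsub hg.continuous hgc hgsub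
  refine ⟨C, Measure.eqOn_Icc_of_ae_eq volume hab.ne ?_ hU continuousOn_const⟩
  rw [← restrict_Ioo_eq_restrict_Icc]
  filter_upwards [(ae_restrict_iff' measurableSet_Ioo).2 hae] with t ht using sub_eq_zero.1 ht

theorem integral_deriv_mul_primitive {θ β : ℝ → ℝ} (hθ : ContDiff ℝ 1 θ) (ha : θ a = 0)
    (hb : θ b = 0) (hβ : IntervalIntegrable β volume a b) :
    ∫ t in a..b, deriv θ t * ∫ r in a..t, β r = -∫ t in a..b, θ t * β t := by
  have hibp := (hβ.absolutelyContinuousOnInterval_intervalIntegral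
    (left_mem_uIcc)).integral_mul_deriv_eq_deriv_mul
      (hθ.contDiffOn.absolutelyContinuousOnInterval (a := a) (b := b))
  simp only [ha, hb, mul_zero, sub_zero, zero_sub] at hibp
  simp only [mul_comm (deriv θ _)]
  rw [hibp, neg_inj]
  refine intervalIntegral.integral_congr_ae ?_
  filter_upwards [hβ.ae_hasDerivAt_integral] with t ht htab
  rw [(ht (uIoc_subset_uIcc htab) a left_mem_uIcc).deriv, mul_comm]

theorem sub_eq_integral_of_weak_deriv (hab : a < b) {u β : ℝ → ℝ} (hu : ContinuousOn u (Icc a b))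
    (hβ : IntervalIntegrable β volume a b)
    (hweak : ∀ θ : ℝ → ℝ, ContDiff ℝ 1 θ → HasCompactSupport θ → tsupport θ ⊆ Ioo a b →
      (∫ t in Ioo a b, deriv θ t * u t) + ∫ t in Ioo a b, θ t * β t = 0)
    {s t : ℝ} (hs : s ∈ Icc a b) (ht : t ∈ Icc a b) : u t - u s = ∫ r in s..t, β r := by
  have hprim : ContinuousOn (fun t => ∫ r in a..t, β r) (Icc a b) := by
    simpa only [uIcc_of_le hab.le] using
      intervalIntegral.continuousOn_primitive_interval' hβ left_mem_uIcc
  obtain ⟨C, hC⟩ := exists_eqOn_const_of_integral_deriv_mul_eq_zero hab (hu.sub hprim) (by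
    intro θ hθ hθc hθsub
    have hvanish : ∀ t ∉ Ioo a b, θ t = 0 := fun t ht =>
      image_eq_zero_of_notMem_tsupport fun ht' => ht (hθsub ht')
    have hibp := integral_deriv_mul_primitive hθ (hvanish a (by simp)) (hvanish b (by simp)) hβ
    simp only [intervalIntegral.integral_of_le hab.le, integral_Ioc_eq_integral_Ioo] at hibp
    have hθ' := hθ.continuous_deriv le_rfl
    simp only [Pi.sub_apply, mul_sub]
    rw [integral_sub (integrableOn_Ioo_mul hθ' hu) (integrableOn_Ioo_mul hθ' hprim)]
    linarith [hweak θ hθ hθc hθsub])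
  have hsub : ∀ {r}, r ∈ Icc a b → IntervalIntegrable β volume a r := fun hr =>
    hβ.mono_set (uIcc_subset_uIcc left_mem_uIcc (by rwa [uIcc_of_le hab.le]))
  rw [← intervalIntegral.integral_interval_sub_left (hsub ht) (hsub hs)]
  have := (hC ht).trans (hC hs).symm
  simp only [Pi.sub_apply] at this
  linarith

end WeakTimeDerivative

section SpaceTime

theorem eLpNorm_comp_snd {α β E : Type*} [MeasurableSpace α] [MeasurableSpace β]
    [NormedAddCommGroup E] (μ : Measure α) {ν : Measure β} [SFinite ν] {p : ℝ≥0∞} (hp : p ≠ ⊤)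
    {f : β → E} (hf : AEStronglyMeasurable f ν) :
    eLpNorm (fun z : α × β => f z.2) p (μ.prod ν)
      = μ univ ^ (1 / p).toReal * eLpNorm f p ν := by
  have hmap : AEStronglyMeasurable f (Measure.map Prod.snd (μ.prod ν)) := by
    rw [Measure.map_snd_prod]
    exact hf.smul_measure _
  rw [← smul_eq_mul, ← eLpNorm_smul_measure_of_ne_top hp, ← Measure.map_snd_prod,
    eLpNorm_map_measure hmap measurable_snd.aemeasurable]
  rfl

theorem tendsto_eLpNorm_comp_snd {α β E : Type*} [MeasurableSpace α] [MeasurableSpace β]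
    [NormedAddCommGroup E] (μ : Measure α) [IsFiniteMeasure μ] {ν : Measure β} [SFinite ν]
    {p : ℝ≥0∞} (hp : p ≠ ⊤) {f : ℕ → β → E} (hf : ∀ k, AEStronglyMeasurable (f k) ν)
    (h : Tendsto (fun k => eLpNorm (f k) p ν) atTop (𝓝 0)) :
    Tendsto (fun k => eLpNorm (fun z : α × β => f k z.2) p (μ.prod ν)) atTop (𝓝 0) := by
  simp only [eLpNorm_comp_snd μ hp (hf _)]
  simpa only [mul_zero] using ENNReal.Tendsto.const_mul h
    (.inr (ENNReal.rpow_ne_top_of_nonneg ENNReal.toReal_nonneg (measure_ne_top μ univ)))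

variable {Ω : Set Space} {T t : ℝ}

theorem spaceTime_mono (h : t ≤ T) : spaceTime Ω t ≤ spaceTime Ω T :=
  Measure.prod_mono (Measure.restrict_mono (Ioo_subset_Ioo_right h) le_rfl) le_rfl

theorem spaceTime_eq_restrict :
    spaceTime Ω T = (volume.prod volume).restrict (Ioo 0 T ×ˢ Ω) :=
  Measure.prod_restrict _ _

theorem integral_spaceTime_eq {E : Type*} [NormedAddCommGroup E] [NormedSpace ℝ E]
    (ht : t ∈ Icc 0 T) {f : ℝ × Space → E} (hf : Integrable f (spaceTime Ω T)) :
    ∫ p, f p ∂spaceTime Ω t = ∫ s in (0 : ℝ)..t, ∫ x in Ω, f (s, x) := by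
  rw [intervalIntegral.integral_of_le ht.1, integral_Ioc_eq_integral_Ioo, spaceTime,
    integral_prod _ (hf.mono_measure (spaceTime_mono ht.2))]

theorem intervalIntegrable_integral {E : Type*} [NormedAddCommGroup E] [NormedSpace ℝ E]
    (hT : 0 ≤ T) {f : ℝ × Space → E} (hf : Integrable f (spaceTime Ω T)) :
    IntervalIntegrable (fun s => ∫ x in Ω, f (s, x)) volume 0 T :=
  (intervalIntegrable_iff_integrableOn_Ioo_of_le hT).2 hf.integral_prod_left

theorem isTestFunction_mul {θ : ℝ → ℝ} {ψ : Space → ℝ} (hθ : ContDiff ℝ 1 θ)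
    (hθc : HasCompactSupport θ) (hθT : tsupport θ ⊆ Ioo 0 T) (hψ : ContDiff ℝ 1 ψ)
    (hψc : HasCompactSupport ψ) : IsTestFunction T fun p => θ p.1 * ψ p.2 := by
  have hsub : tsupport (fun p : ℝ × Space => θ p.1 * ψ p.2) ⊆ tsupport θ ×ˢ tsupport ψ := by
    refine closure_minimal (fun p hp => ?_) ((isClosed_tsupport _).prod (isClosed_tsupport _))
    exact ⟨subset_tsupport _ (left_ne_zero_of_mul hp), subset_tsupport _ (right_ne_zero_of_mul hp)⟩
  exact ⟨(hθ.comp contDiff_fst).mul (hψ.comp contDiff_snd),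
    (hθc.isCompact.prod hψc.isCompact).of_isClosed_subset (isClosed_tsupport _) hsub,
    hsub.trans (prod_mono hθT (subset_univ _))⟩

end SpaceTime

section ContinuousInL2

variable {Ω : Set Space} {T : ℝ} {a : ℝ → Space → ℝ}

theorem ContinuousInL2.continuous_toLp (h : ContinuousInL2 Ω T a) :
    Continuous fun t : Icc 0 T => (h t t.2).1.toLp (a t) := by
  refine continuous_iff_continuousAt.2 fun t => ?_
  refine (Lp.tendsto_Lp_iff_tendsto_eLpNorm'' _ (fun s : Icc 0 T => (h s s.2).1) _ _).2 ?_
  exact (h t t.2).2.comp (tendsto_nhdsWithin_of_tendsto_nhds_of_eventually_within _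
    continuous_subtype_val.continuousAt (.of_forall Subtype.prop))

theorem ContinuousInL2.continuousOn_integral_mul (h : ContinuousInL2 Ω T a) {ψ : Space → ℝ}
    (hψ : MemLp ψ 2 (volume.restrict Ω)) :
    ContinuousOn (fun t => ∫ x in Ω, a t x * ψ x) (Icc 0 T) := by
  rw [continuousOn_iff_continuous_domRestrict]
  refine ((continuous_const (y := hψ.toLp ψ)).inner h.continuous_toLp).congr fun t => ?_
  rw [← integral_inner_eq_inner_toLp]
  rfl

theorem ContinuousInL2.exists_subseq_tendsto_ae (h : ContinuousInL2 Ω T a) {t : ℝ}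
    (ht : t ∈ Icc 0 T) {u : ℕ → ℝ} (hu : ∀ k, u k ∈ Icc 0 T) (hut : Tendsto u atTop (𝓝 t)) :
    ∃ φ : ℕ → ℕ, StrictMono φ ∧
      ∀ᵐ x ∂volume.restrict Ω, Tendsto (fun k => a (u (φ k)) x) atTop (𝓝 (a t x)) :=
  (tendstoInMeasure_of_tendsto_eLpNorm two_ne_zero (fun k => (h _ (hu k)).1.1) (h t ht).1.1
    ((h t ht).2.comp (tendsto_nhdsWithin_iff.2 ⟨hut, .of_forall hu⟩))).exists_seq_tendsto_ae

theorem ContinuousInL2.ae_mem_of_isClosed (hT : 0 < T) (h : ContinuousInL2 Ω T a) {S : Set ℝ}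
    (hS : IsClosed S)
    (hmem : ∀ᵐ s ∂volume.restrict (Ioo 0 T), ∀ᵐ x ∂volume.restrict Ω, a s x ∈ S) {t : ℝ}
    (ht : t ∈ Icc 0 T) : ∀ᵐ x ∂volume.restrict Ω, a t x ∈ S := by
  have hdense := Measure.dense_of_ae ((ae_restrict_iff' measurableSet_Ioo).1 hmem)
  rw [← closure_Ioo hT.ne] at ht
  obtain ⟨u, hu, hut⟩ := mem_closure_iff_seq_limit.1
    (closure_minimal (hdense.open_subset_closure_inter isOpen_Ioo) isClosed_closure ht)
  rw [closure_Ioo hT.ne] at ht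
  obtain ⟨φ, -, hφ⟩ := h.exists_subseq_tendsto_ae ht (fun k => Ioo_subset_Icc_self (hu k).1) hut
  filter_upwards [hφ, ae_all_iff.2 fun k => (hu (φ k)).2 (hu (φ k)).1] with x hlim hx
  exact hS.mem_of_tendsto hlim (.of_forall hx)

theorem ContinuousInL2.continuousOn_integral_comp (hΩ : volume Ω ≠ ⊤) (h : ContinuousInL2 Ω T a)
    {S : Set ℝ} (hS : IsCompact S)
    (hmem : ∀ t ∈ Icc 0 T, ∀ᵐ x ∂volume.restrict Ω, a t x ∈ S) {F : ℝ → ℝ} (hF : Continuous F) :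
    ContinuousOn (fun t => ∫ x in Ω, F (a t x)) (Icc 0 T) := by
  have : IsFiniteMeasure (volume.restrict Ω) := isFiniteMeasure_restrict.2 hΩ
  obtain ⟨C, hC⟩ := hS.exists_bound_of_continuousOn hF.continuousOn
  refine fun t ht => tendsto_of_subseq_tendsto fun u hu => ?_
  obtain ⟨hut, hev⟩ := tendsto_nhdsWithin_iff.1 hu
  obtain ⟨N, hN⟩ := eventually_atTop.1 hev
  obtain ⟨φ, -, hφ⟩ := h.exists_subseq_tendsto_ae ht (u := fun k => u (k + N))
    (fun k => hN _ (Nat.le_add_left N k)) (hut.comp (tendsto_add_atTop_nat N))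
  have hIcc : ∀ k, u (φ k + N) ∈ Icc 0 T := fun k => hN _ (Nat.le_add_left N _)
  refine ⟨fun k => φ k + N, tendsto_integral_of_dominated_convergence (fun _ => C)
    (fun k => hF.comp_aestronglyMeasurable (h _ (hIcc k)).1.1) (integrable_const C)
    (fun k => (hmem _ (hIcc k)).mono fun x hx => hC _ hx) ?_⟩
  filter_upwards [hφ] with x hx using (hF.tendsto _).comp hx

end ContinuousInL2

section ConservationLaw

/-- The weak form of `∂ₜ a + div J = 0` on `(0, T) × Ω` with no flux through `∂Ω`, for a
concentration continuous in time with values in `L²(Ω)` and a square integrable flux. -/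
structure IsConserved (Ω : Set Space) (T : ℝ) (a : ℝ → Space → ℝ) (J : ℝ → Space → Space) :
    Prop where
  continuousInL2 : ContinuousInL2 Ω T a
  memLp_flux : MemLp (fun p : ℝ × Space => J p.1 p.2) 2 (spaceTime Ω T)
  weak_form : ∀ φ : ℝ × Space → ℝ, IsTestFunction T φ →
    (∫ t in Ioo 0 T, ∫ x in Ω, a t x * deriv (fun s => φ (s, x)) t) +
      (∫ t in Ioo 0 T, ∫ x in Ω, inner ℝ (J t x) (gradient (fun y => φ (t, y)) x)) = 0

namespace IsConserved

variable {Ω : Set Space} {T : ℝ} {a : ℝ → Space → ℝ} {J : ℝ → Space → Space}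

theorem integrable_inner_flux (h : IsConserved Ω T a J) {K : Space → Space}
    (hK : MemLp K 2 (volume.restrict Ω)) :
    Integrable (fun p : ℝ × Space => inner ℝ (J p.1 p.2) (K p.2)) (spaceTime Ω T) :=
  integrable_inner h.memLp_flux (hK.comp_snd _)

theorem integral_sub_of_test (hT : 0 < T) (h : IsConserved Ω T a J) {ψ : Space → ℝ}
    (hψ : ContDiff ℝ 1 ψ) (hψc : HasCompactSupport ψ) {s t : ℝ} (hs : s ∈ Icc 0 T)
    (ht : t ∈ Icc 0 T) :
    (∫ x in Ω, a t x * ψ x) - ∫ x in Ω, a s x * ψ x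
      = ∫ r in s..t, ∫ x in Ω, inner ℝ (J r x) (gradient ψ x) := by
  have hψL : MemLp ψ 2 (volume.restrict Ω) :=
    (hψ.continuous.memLp_of_hasCompactSupport hψc).restrict Ω
  have hψL' : MemLp (gradient ψ) 2 (volume.restrict Ω) :=
    ((continuous_gradient hψ).memLp_of_hasCompactSupport
      (hasCompactSupport_gradient hψc)).restrict Ω
  refine sub_eq_integral_of_weak_deriv hT (h.continuousInL2.continuousOn_integral_mul hψL)
    (intervalIntegrable_integral hT.le (h.integrable_inner_flux hψL')) (fun θ hθ hθc hθT => ?_)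
    hs ht
  have hderiv : ∀ r x, a r x * deriv (fun q => θ q * ψ x) r = deriv θ r * (a r x * ψ x) :=
    fun r x => by rw [deriv_mul_const (hθ.differentiable one_ne_zero r)]; ring
  have hgrad : ∀ r x, inner ℝ (J r x) (gradient (fun y => θ r * ψ y) x)
      = θ r * inner ℝ (J r x) (gradient ψ x) := fun r x => by
    rw [gradient_const_mul _ (hψ.differentiable one_ne_zero x), real_inner_smul_right]
  simpa only [hderiv, hgrad, integral_const_mul] using
    h.weak_form _ (isTestFunction_mul hθ hθc hθT hψ hψc)

theorem integral_sub_zero (hT : 0 < T) (h : IsConserved Ω T a J) {ψ : Space → ℝ}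
    {K : Space → Space} (hψ : IsC1Limit (volume.restrict Ω) ψ K) {t : ℝ} (ht : t ∈ Icc 0 T) :
    (∫ x in Ω, a t x * ψ x) - ∫ x in Ω, a 0 x * ψ x
      = ∫ r in (0 : ℝ)..t, ∫ x in Ω, inner ℝ (J r x) (K x) := by
  have h0 : (0 : ℝ) ∈ Icc 0 T := ⟨le_rfl, hT.le⟩
  obtain ⟨ψk, hC1, hc, hψk, hgradk⟩ := hψ.exists_seq
  have hψL := fun k => ((hC1 k).continuous.memLp_of_hasCompactSupport (p := 2) (μ := volume)
    (hc k)).restrict Ω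
  have hgradL := fun k => ((continuous_gradient (hC1 k)).memLp_of_hasCompactSupport (p := 2)
    (μ := volume) (hasCompactSupport_gradient (hc k))).restrict Ω
  have hlim : ∀ {r}, r ∈ Icc 0 T →
      Tendsto (fun k => ∫ x in Ω, a r x * ψk k x) atTop (𝓝 (∫ x in Ω, a r x * ψ x)) := fun hr => by
    simpa only [RCLike.inner_apply, conj_trivial, mul_comm] using
      tendsto_integral_inner (h.continuousInL2 _ hr).1 hψL hψ.memLp hψk
  have hgradk' : Tendsto (fun k => eLpNorm ((fun p : ℝ × Space => gradient (ψk k) p.2) -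
      fun p => K p.2) 2 (spaceTime Ω t)) atTop (𝓝 0) :=
    tendsto_eLpNorm_comp_snd (f := fun k => gradient (ψk k) - K) _ (by simp)
      (fun k => (hgradL k).1.sub hψ.memLp_gradient.1) hgradk
  have hconv := tendsto_integral_inner (h.memLp_flux.mono_measure (spaceTime_mono ht.2))
    (fun k => (hgradL k).comp_snd _) (hψ.memLp_gradient.comp_snd _) hgradk'
  have hpair : ∀ {L : Space → Space}, MemLp L 2 (volume.restrict Ω) →
      ∫ p, inner ℝ (J p.1 p.2) (L p.2) ∂spaceTime Ω t
        = ∫ r in (0 : ℝ)..t, ∫ x in Ω, inner ℝ (J r x) (L x) := fun hL =>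
    integral_spaceTime_eq ht (h.integrable_inner_flux hL)
  rw [← hpair hψ.memLp_gradient]
  refine tendsto_nhds_unique ((hlim ht).sub (hlim h0)) (hconv.congr fun k => ?_)
  rw [hpair (hgradL k), h.integral_sub_of_test hT (hC1 k) (hc k) h0 ht]

theorem integral_sub (hT : 0 < T) (h : IsConserved Ω T a J) {ψ : Space → ℝ} {K : Space → Space}
    (hψ : IsC1Limit (volume.restrict Ω) ψ K) {s t : ℝ} (hs : s ∈ Icc 0 T) (ht : t ∈ Icc 0 T) :
    (∫ x in Ω, a t x * ψ x) - ∫ x in Ω, a s x * ψ x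
      = ∫ r in s..t, ∫ x in Ω, inner ℝ (J r x) (K x) := by
  have hint : ∀ {r}, r ∈ Icc 0 T →
      IntervalIntegrable (fun q => ∫ x in Ω, inner ℝ (J q x) (K x)) volume 0 r := fun hr =>
    (intervalIntegrable_integral hT.le (h.integrable_inner_flux hψ.memLp_gradient)).mono_set
      (uIcc_subset_uIcc left_mem_uIcc (by rwa [uIcc_of_le hT.le]))
  rw [← intervalIntegral.integral_interval_sub_left (hint ht) (hint hs),
    ← h.integral_sub_zero hT hψ ht, ← h.integral_sub_zero hT hψ hs]
  ring

end IsConserved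

end ConservationLaw

section TimeCorrelation

theorem comp_add_eq_time_translate {X E : Type*} [AddZeroClass X] (J : ℝ × X → E) (σ : ℝ) :
    J ∘ ((σ, (0 : X)) + ·) = fun p => J (σ + p.1, p.2) := by
  ext p
  simp [Prod.add_def]

variable {X E : Type*} [NormedAddCommGroup X] [NormedSpace ℝ X] [FiniteDimensional ℝ X]
  [MeasurableSpace X] [BorelSpace X] {μ : Measure X} [μ.IsAddHaarMeasure] [NormedAddCommGroup E]
  {J K : ℝ × X → E}

theorem memLp_time_translate {p : ℝ≥0∞} (hJ : MemLp J p (volume.prod μ)) (σ : ℝ) :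
    MemLp (fun z : ℝ × X => J (σ + z.1, z.2)) p (volume.prod μ) := by
  rw [← comp_add_eq_time_translate]
  exact hJ.comp_measurePreserving (measurePreserving_add_left _ _)

variable [InnerProductSpace ℝ E]

/-- The correlation of two space-time fields at time lag `σ`. -/
noncomputable def timeCorrelation (μ : Measure X) (J K : ℝ × X → E) (σ : ℝ) : ℝ :=
  ∫ p, inner ℝ (J (σ + p.1, p.2)) (K p) ∂(volume.prod μ)

theorem continuous_timeCorrelation (hJ : MemLp J 2 (volume.prod μ))
    (hK : MemLp K 2 (volume.prod μ)) : Continuous (timeCorrelation μ J K) := by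
  have : Fact ((2 : ℝ≥0∞) ≠ ⊤) := ⟨ENNReal.ofNat_ne_top⟩
  refine (((continuous_toLp_translate hJ).comp (by fun_prop :
    Continuous fun σ : ℝ => (σ, (0 : X)))).inner (continuous_const (y := hK.toLp K))).congr
    fun σ => ?_
  rw [Function.comp_apply, ← integral_inner_eq_inner_toLp, comp_add_eq_time_translate,
    timeCorrelation]

theorem integrable_inner_time_translate (hJ : MemLp J 2 (volume.prod μ))
    (hK : MemLp K 2 (volume.prod μ)) (ρ : Measure ℝ) [IsFiniteMeasure ρ] :
    Integrable (fun z : ℝ × ℝ => ∫ x, inner ℝ (J (z.1 + z.2, x)) (K (z.2, x)) ∂μ)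
      (ρ.prod volume) := by
  have hshear : MeasurePreserving (fun z : ℝ × ℝ × X => (z.1, (z.1 + z.2.1, z.2.2)))
      (ρ.prod (volume.prod μ)) (ρ.prod (volume.prod μ)) := by
    refine (MeasurePreserving.id _).skew_product (g := fun σ (p : ℝ × X) => (σ + p.1, p.2))
      (by fun_prop) (Eventually.of_forall fun σ => ?_)
    simpa [Prod.add_def] using (measurePreserving_add_left (volume.prod μ) (σ, (0 : X))).map_eq
  have hint := integrable_inner ((hJ.comp_snd ρ).comp_measurePreserving hshear) (hK.comp_snd ρ)
  exact (((measurePreserving_prodAssoc ρ volume μ).integrable_comp_emb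
    MeasurableEquiv.prodAssoc.measurableEmbedding).2 hint).integral_prod_left

theorem integrable_intervalIntegral_inner_time_translate (hJ : MemLp J 2 (volume.prod μ))
    (hK : MemLp K 2 (volume.prod μ)) (a b : ℝ) :
    Integrable fun t => ∫ σ in a..b, ∫ x, inner ℝ (J (σ + t, x)) (K (t, x)) ∂μ :=
  (integrable_inner_time_translate hJ hK _).integral_prod_right.sub
    (integrable_inner_time_translate hJ hK _).integral_prod_right

theorem integral_timeCorrelation (hJ : MemLp J 2 (volume.prod μ))
    (hK : MemLp K 2 (volume.prod μ)) (a b : ℝ) :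
    ∫ σ in a..b, timeCorrelation μ J K σ
      = ∫ t, ∫ σ in a..b, ∫ x, inner ℝ (J (σ + t, x)) (K (t, x)) ∂μ := by
  have hfubini : ∀ σ, timeCorrelation μ J K σ
      = ∫ t, ∫ x, inner ℝ (J (σ + t, x)) (K (t, x)) ∂μ := fun σ =>
    integral_prod _ (integrable_inner (memLp_time_translate hJ σ) hK)
  have hint := fun I : Set ℝ => fun hI : IsFiniteMeasure (volume.restrict I) =>
    integrable_inner_time_translate hJ hK (volume.restrict I)
  simp only [hfubini, intervalIntegral]
  rw [integral_sub (hint _ inferInstance).integral_prod_right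
    (hint _ inferInstance).integral_prod_right]
  exact congrArg₂ _ (integral_integral_swap (hint _ inferInstance))
    (integral_integral_swap (hint _ inferInstance))

/-- Both sides vanish at `τ = 0`, so the inequality forces their derivatives there to agree. -/
theorem sub_eq_of_forall_integral_le {Φ g : ℝ → ℝ} (hΦ : Continuous Φ) (hg : Continuous g)
    {a b : ℝ} (hle : ∀ τ, ∫ σ in (0 : ℝ)..τ, g σ ≤ ∫ t in a..b, (Φ (τ + t) - Φ t)) :
    Φ b - Φ a = g 0 := by
  have hΦi := fun a b => hΦ.intervalIntegrable (μ := volume) a b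
  have hprim : ∀ y, HasDerivAt (fun y => ∫ r in (0 : ℝ)..y, Φ r) (Φ y) y := fun y =>
    intervalIntegral.integral_hasDerivAt_right (hΦi _ _) (hΦ.stronglyMeasurableAtFilter _ _)
      hΦ.continuousAt
  have hΦτ : ∀ τ, Continuous fun t => Φ (τ + t) := fun τ => hΦ.comp (continuous_const_add τ)
  have hshift : ∀ τ, ∫ t in a..b, (Φ (τ + t) - Φ t) = (∫ r in (0 : ℝ)..b + τ, Φ r)
      - (∫ r in (0 : ℝ)..a + τ, Φ r) - ∫ t in a..b, Φ t := fun τ => by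
    rw [intervalIntegral.integral_sub ((hΦτ τ).intervalIntegrable _ _) (hΦi _ _),
      intervalIntegral.integral_comp_add_left Φ τ,
      intervalIntegral.integral_interval_sub_left (hΦi _ _) (hΦi _ _), add_comm τ b, add_comm τ a]
  have hderiv : HasDerivAt (fun τ => (∫ t in a..b, (Φ (τ + t) - Φ t)) - ∫ σ in (0 : ℝ)..τ, g σ)
      (Φ b - Φ a - g 0) 0 := by
    simp only [hshift]
    have hprimτ : ∀ y, HasDerivAt (fun τ => ∫ r in (0 : ℝ)..y + τ, Φ r) (Φ y) 0 := fun y =>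
      HasDerivAt.comp_const_add y 0 (by simpa using hprim y)
    exact (((hprimτ b).sub (hprimτ a)).sub_const _).sub
      (intervalIntegral.integral_hasDerivAt_right (hg.intervalIntegrable _ _)
        (hg.stronglyMeasurableAtFilter _ _) hg.continuousAt)
  have hmin : IsLocalMin
      (fun τ => (∫ t in a..b, (Φ (τ + t) - Φ t)) - ∫ σ in (0 : ℝ)..τ, g σ) 0 :=
    Eventually.of_forall fun τ => by simpa using hle τ
  exact sub_eq_zero.1 (hmin.hasDerivAt_eq_zero hderiv)

theorem sub_eq_timeCorrelation_zero (hJ : MemLp J 2 (volume.prod μ))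
    (hK : MemLp K 2 (volume.prod μ)) {Φ : ℝ → ℝ} (hΦ : Continuous Φ) {a b : ℝ} (hab : a ≤ b)
    (hsupp : ∀ t ∉ Ioo a b, ∀ x, K (t, x) = 0)
    (hle : ∀ᵐ t ∂volume.restrict (Ioo a b), ∀ s,
      ∫ r in t..s, ∫ x, inner ℝ (J (r, x)) (K (t, x)) ∂μ ≤ Φ s - Φ t) :
    Φ b - Φ a = timeCorrelation μ J K 0 := by
  refine sub_eq_of_forall_integral_le hΦ (continuous_timeCorrelation hJ hK) fun τ => ?_
  have hoff : ∀ t ∉ Ioo a b,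
      ∫ σ in (0 : ℝ)..τ, ∫ x, inner ℝ (J (σ + t, x)) (K (t, x)) ∂μ = 0 := fun t ht => by
    simp [hsupp t ht]
  rw [integral_timeCorrelation hJ hK, intervalIntegral.integral_of_le hab,
    integral_Ioc_eq_integral_Ioo, ← setIntegral_eq_integral_of_forall_compl_eq_zero hoff]
  refine integral_mono_ae
    (integrable_intervalIntegral_inner_time_translate hJ hK 0 τ).integrableOn
    (((by fun_prop : Continuous fun t => Φ (τ + t) - Φ t).integrableOn_Icc).mono_set
      Ioo_subset_Icc_self) ?_
  filter_upwards [hle] with t ht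
  simpa [intervalIntegral.integral_comp_add_right
    (fun r => ∫ x, inner ℝ (J (r, x)) (K (t, x)) ∂μ)] using ht (τ + t)

end TimeCorrelation

section ChainRule

theorem intervalIntegral_indicator_Ioo {E : Type*} [NormedAddCommGroup E] [NormedSpace ℝ E]
    {a b : ℝ} (hab : a ≤ b) {f : ℝ → E} (hf : IntegrableOn f (Ioo a b)) {t : ℝ}
    (ht : t ∈ Icc a b) (s : ℝ) :
    ∫ r in t..s, (Ioo a b).indicator f r = ∫ r in t..projIcc a b hab s, f r := by
  have hint := fun u v => (hf.integrable_indicator measurableSet_Ioo).intervalIntegrable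
    (a := u) (b := v)
  have hout : EqOn ((Ioo a b).indicator f) 0 (uIoo (projIcc a b hab s) s) := fun r hr => by
    refine indicator_of_notMem (fun hrab => ?_) f
    rw [coe_projIcc, uIoo, mem_Ioo] at hr
    rw [mem_Ioo] at hrab
    grind
  rw [← intervalIntegral.integral_add_adjacent_intervals (hint t (projIcc a b hab s)) (hint _ s),
    intervalIntegral.integral_congr_uIoo hout, intervalIntegral.integral_congr_uIoo (g := f)]
  · simp
  · exact fun r hr => indicator_of_mem (uIoo_subset_Ioo ht (projIcc a b hab s).2 hr) f

theorem integral_inner_indicator_prod {X E : Type*} [MeasurableSpace X] {μ : Measure X}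
    [NormedAddCommGroup E] [InnerProductSpace ℝ E] {Ω : Set X} (hΩ : MeasurableSet Ω)
    {I I' : Set ℝ} {t : ℝ} (ht : t ∈ I') (J K : ℝ × X → E) (r : ℝ) :
    ∫ x, inner ℝ ((I ×ˢ Ω).indicator J (r, x)) ((I' ×ˢ Ω).indicator K (t, x)) ∂μ
      = I.indicator (fun r => ∫ x in Ω, inner ℝ (J (r, x)) (K (t, x)) ∂μ) r := by
  have hspace : ∀ x, inner ℝ ((I ×ˢ Ω).indicator J (r, x)) ((I' ×ˢ Ω).indicator K (t, x))
      = I.indicator (fun r => Ω.indicator (fun x => inner ℝ (J (r, x)) (K (t, x))) x) r :=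
    fun x => by by_cases hr : r ∈ I <;> by_cases hx : x ∈ Ω <;> simp [ht, hr, hx]
  simp only [hspace]
  by_cases hr : r ∈ I
  · simp only [indicator_of_mem hr, integral_indicator hΩ]
  · simp only [indicator_of_notMem hr, integral_zero]

variable {Ω : Set Space} {T : ℝ}

theorem memLp_indicator_iff_spaceTime (hΩ : MeasurableSet Ω) {E : Type*} [NormedAddCommGroup E]
    {f : ℝ × Space → E} {p : ℝ≥0∞} :
    MemLp ((Ioo 0 T ×ˢ Ω).indicator f) p (volume.prod volume) ↔ MemLp f p (spaceTime Ω T) := by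
  rw [memLp_indicator_iff_restrict (measurableSet_Ioo.prod hΩ), spaceTime_eq_restrict]

theorem IsConserved.chain_rule (hΩ : MeasurableSet Ω) (hT : 0 < T)
    {a : ℝ → Space → ℝ} {J : ℝ → Space → Space} (h : IsConserved Ω T a J)
    {ψ : ℝ → Space → ℝ} {K : ℝ → Space → Space}
    (hK : MemLp (fun p : ℝ × Space => K p.1 p.2) 2 (spaceTime Ω T))
    (hψ : ∀ᵐ t ∂volume.restrict (Ioo 0 T), IsC1Limit (volume.restrict Ω) (ψ t) (K t))
    {Φ : ℝ → ℝ} (hΦ : ContinuousOn Φ (Icc 0 T))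
    (hle : ∀ᵐ t ∂volume.restrict (Ioo 0 T), ∀ s ∈ Icc 0 T,
      (∫ x in Ω, a s x * ψ t x) - ∫ x in Ω, a t x * ψ t x ≤ Φ s - Φ t)
    {b : ℝ} (hb : b ∈ Icc 0 T) :
    Φ b - Φ 0 = ∫ p, inner ℝ (J p.1 p.2) (K p.1 p.2) ∂spaceTime Ω b := by
  set J' : ℝ × Space → Space := (Ioo 0 T ×ˢ Ω).indicator fun p => J p.1 p.2 with hJ'
  set K' : ℝ × Space → Space := (Ioo 0 b ×ˢ Ω).indicator fun p => K p.1 p.2 with hK'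
  have hΦ' : Continuous fun s => Φ (projIcc 0 T hT.le s) :=
    (continuousOn_iff_continuous_domRestrict.1 hΦ).comp continuous_projIcc
  have hproj : ∀ s ∈ Icc 0 T, (projIcc 0 T hT.le s : ℝ) = s := fun s hs => by
    rw [projIcc_of_mem hT.le hs]
  have hincr : ∀ᵐ t ∂volume.restrict (Ioo 0 b), ∀ s,
      ∫ r in t..s, ∫ x, inner ℝ (J' (r, x)) (K' (t, x))
        ≤ Φ (projIcc 0 T hT.le s) - Φ (projIcc 0 T hT.le t) := by
    filter_upwards [ae_restrict_mem measurableSet_Ioo,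
      ae_restrict_of_ae_restrict_of_subset (Ioo_subset_Ioo_right hb.2) hψ,
      ae_restrict_of_ae_restrict_of_subset (Ioo_subset_Ioo_right hb.2) hle] with t ht hψt hlet s
    have htT : t ∈ Icc 0 T := ⟨ht.1.le, ht.2.le.trans hb.2⟩
    simp only [hJ', hK', integral_inner_indicator_prod hΩ ht]
    rw [intervalIntegral_indicator_Ioo hT.le
      (h.integrable_inner_flux hψt.memLp_gradient).integral_prod_left htT,
      ← h.integral_sub hT hψt htT (projIcc 0 T hT.le s).2, hproj t htT]
    exact hlet _ (projIcc 0 T hT.le s).2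
  have hkey := sub_eq_timeCorrelation_zero ((memLp_indicator_iff_spaceTime hΩ).2 h.memLp_flux)
    ((memLp_indicator_iff_spaceTime hΩ).2 (hK.mono_measure (spaceTime_mono hb.2))) hΦ' hb.1
    (fun t ht x => indicator_of_notMem (fun h => ht h.1) _) hincr
  rw [hproj b hb, hproj 0 ⟨le_rfl, hT.le⟩] at hkey
  rw [hkey, timeCorrelation, spaceTime_eq_restrict,
    ← integral_indicator (measurableSet_Ioo.prod hΩ)]
  refine integral_congr_ae (Eventually.of_forall fun p => ?_)
  have hsub : p ∈ Ioo 0 b ×ˢ Ω → p ∈ Ioo 0 T ×ˢ Ω :=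
    fun hp => ⟨Ioo_subset_Ioo_right hb.2 hp.1, hp.2⟩
  by_cases hp : p ∈ Ioo 0 b ×ˢ Ω <;> simp [hp, hsub]

end ChainRule

section ShiftedEntropy

/-- The entropy density with its logarithm shifted by `δ`, a function of the concentration which,
unlike `entropyDensity`, is `C¹` up to `y = 0`. Its derivative is `log (y + δ)`. -/
noncomputable def shiftedEntropy (δ y : ℝ) : ℝ := (y + δ) * Real.log (y + δ) - y

/-- The derivative of `shiftedEntropy δ`, as a function of the square root `w` of the
concentration. -/
noncomputable def shiftedPotential (δ w : ℝ) : ℝ := Real.log (w ^ 2 + δ)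

variable {δ : ℝ}

theorem shiftedEntropy_zero : shiftedEntropy 0 = entropyDensity := by
  ext y
  simp only [entropyDensity, shiftedEntropy, add_zero]
  ring

theorem continuous_shiftedEntropy : Continuous fun p : ℝ × ℝ => shiftedEntropy p.1 p.2 :=
  (Real.continuous_mul_log.comp (continuous_snd.add continuous_fst)).sub continuous_snd

theorem sub_mul_log_le_shiftedEntropy_sub (hδ : 0 < δ) {y z : ℝ} (hy : 0 ≤ y) (hz : 0 ≤ z) :
    (z - y) * Real.log (y + δ) ≤ shiftedEntropy δ z - shiftedEntropy δ y := by
  have hyδ : 0 < y + δ := by positivity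
  have hzδ : 0 < z + δ := by positivity
  have hlog := mul_le_mul_of_nonneg_left
    (Real.one_sub_inv_le_log_of_pos (div_pos hzδ hyδ)) hzδ.le
  rw [Real.log_div hzδ.ne' hyδ.ne', inv_div, mul_sub, mul_one, mul_div_cancel₀ _ hzδ.ne'] at hlog
  unfold shiftedEntropy
  linarith

theorem contDiff_shiftedPotential (hδ : 0 < δ) : ContDiff ℝ 1 (shiftedPotential δ) :=
  ContDiff.log (by fun_prop) fun w => by positivity

theorem deriv_shiftedPotential (hδ : 0 < δ) (w : ℝ) :
    deriv (shiftedPotential δ) w = 2 * w / (w ^ 2 + δ) := by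
  have h : HasDerivAt (fun w : ℝ => w ^ 2 + δ) (2 * w) w := by
    simpa using (hasDerivAt_pow 2 w).add_const δ
  exact (h.log (by positivity)).deriv

theorem abs_deriv_shiftedPotential_le (hδ : 0 < δ) (w : ℝ) :
    |deriv (shiftedPotential δ) w| ≤ 1 + 1 / δ := by
  rw [deriv_shiftedPotential hδ, abs_div, abs_of_pos (by positivity : 0 < w ^ 2 + δ),
    div_le_iff₀ (by positivity), abs_mul, abs_two]
  have hexpand : (1 + 1 / δ) * (w ^ 2 + δ) = w ^ 2 + δ + w ^ 2 / δ + 1 := by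
    field_simp
    ring
  have hnonneg : 0 ≤ w ^ 2 / δ := by positivity
  nlinarith [sq_nonneg (|w| - 1), sq_abs w]

variable {α : Type*} [MeasurableSpace α] {μ : Measure α}

theorem integrable_comp_of_isCompact [IsFiniteMeasure μ] {F : ℝ → ℝ} (hF : Continuous F)
    {f : α → ℝ} (hf : AEStronglyMeasurable f μ) {S : Set ℝ} (hS : IsCompact S)
    (hmem : ∀ᵐ x ∂μ, f x ∈ S) : Integrable (fun x => F (f x)) μ := by
  obtain ⟨C, hC⟩ := hS.exists_bound_of_continuousOn hF.continuousOn
  exact Integrable.of_bound (hF.comp_aestronglyMeasurable hf) C (hmem.mono fun x => hC _)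

theorem tendsto_integral_shiftedEntropy [IsFiniteMeasure μ] {f : α → ℝ}
    (hf : AEStronglyMeasurable f μ) {S : Set ℝ} (hS : IsCompact S) (hmem : ∀ᵐ x ∂μ, f x ∈ S) :
    Tendsto (fun δ => ∫ x, shiftedEntropy δ (f x) ∂μ) (𝓝[>] 0)
      (𝓝 (∫ x, entropyDensity (f x) ∂μ)) := by
  obtain ⟨C, hC⟩ := ((isCompact_Icc (a := (0 : ℝ)) (b := 1)).prod hS).exists_bound_of_continuousOn
    continuous_shiftedEntropy.continuousOn
  rw [← shiftedEntropy_zero]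
  refine tendsto_integral_filter_of_dominated_convergence (fun _ => C)
    (.of_forall fun δ => (continuous_shiftedEntropy.comp
      (Continuous.prodMk_right δ)).comp_aestronglyMeasurable hf) ?_ (integrable_const C)
    (.of_forall fun x => ((continuous_shiftedEntropy.comp
      (Continuous.prodMk_left (f x))).tendsto 0).mono_left nhdsWithin_le_nhds)
  filter_upwards [Ioo_mem_nhdsGT one_pos] with δ hδ
  filter_upwards [hmem] with x hx using hC (δ, f x) ⟨Ioo_subset_Icc_self hδ, hx⟩

theorem tendsto_integral_div_add_mul {c f : α → ℝ} (hc : AEStronglyMeasurable c μ)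
    (hf : Integrable f μ) (hnonneg : ∀ᵐ x ∂μ, 0 ≤ c x) :
    Tendsto (fun δ => ∫ x, c x / (c x + δ) * f x ∂μ) (𝓝[>] 0)
      (𝓝 (∫ x, if 0 < c x then f x else 0 ∂μ)) := by
  refine tendsto_integral_filter_of_dominated_convergence (fun x => ‖f x‖) (.of_forall fun δ =>
    ((hc.aemeasurable.div (hc.aemeasurable.add_const δ)).mul
      hf.1.aemeasurable).aestronglyMeasurable) ?_ hf.norm ?_
  · filter_upwards [self_mem_nhdsWithin] with δ (hδ : 0 < δ)
    filter_upwards [hnonneg] with x hx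
    rw [norm_mul, Real.norm_of_nonneg (by positivity)]
    exact mul_le_of_le_one_left (norm_nonneg _) (div_le_one_of_le₀ (by linarith) (by linarith))
  · filter_upwards [hnonneg] with x hx
    rcases hx.eq_or_lt with hzero | hpos
    · simp [← hzero]
    · have hlim : Tendsto (fun δ => c x / (c x + δ) * f x) (𝓝 0) (𝓝 (c x / (c x + 0) * f x)) :=
        (tendsto_const_nhds.div (tendsto_const_nhds.add tendsto_id)
          (by simpa using hpos.ne')).mul_const _
      rw [add_zero, div_self hpos.ne', one_mul] at hlim
      simpa only [if_pos hpos] using hlim.mono_left nhdsWithin_le_nhds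

theorem integral_mul_shiftedPotential_sub_le [IsFiniteMeasure μ] (hδ : 0 < δ) {f g : α → ℝ}
    {M : ℝ} (hf : MemLp f 2 μ) (hg : MemLp g 2 μ) (hfM : ∀ᵐ x ∂μ, f x ∈ Icc 0 M)
    (hgM : ∀ᵐ x ∂μ, g x ∈ Icc 0 M) (hψ : MemLp (fun x => shiftedPotential δ √(f x)) 2 μ) :
    (∫ x, g x * shiftedPotential δ √(f x) ∂μ) - ∫ x, f x * shiftedPotential δ √(f x) ∂μ
      ≤ (∫ x, shiftedEntropy δ (g x) ∂μ) - ∫ x, shiftedEntropy δ (f x) ∂μ := by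
  have hη : Continuous (shiftedEntropy δ) :=
    continuous_shiftedEntropy.comp (Continuous.prodMk_right δ)
  have hηf := integrable_comp_of_isCompact hη hf.1 isCompact_Icc hfM
  have hηg := integrable_comp_of_isCompact hη hg.1 isCompact_Icc hgM
  have hψf : Integrable (fun x => f x * shiftedPotential δ √(f x)) μ := hf.integrable_mul hψ
  have hψg : Integrable (fun x => g x * shiftedPotential δ √(f x)) μ := hg.integrable_mul hψ
  rw [← integral_sub hψg hψf, ← integral_sub hηg hηf]
  refine integral_mono_ae (hψg.sub hψf) (hηg.sub hηf) ?_
  filter_upwards [hfM, hgM] with x hfx hgx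
  simpa only [shiftedPotential, Real.sq_sqrt hfx.1, sub_mul] using
    sub_mul_log_le_shiftedEntropy_sub hδ hfx.1 hgx.1

end ShiftedEntropy

section EntropyBalance

theorem sqrt_smul_velocity {a : ℝ} (v : Space) :
    √a • velocity a v = if 0 < a then v else 0 := by
  split_ifs with ha
  · rw [velocity, smul_inv_smul₀ (Real.sqrt_pos.2 ha).ne']
  · rw [Real.sqrt_eq_zero_of_nonpos (not_lt.1 ha), zero_smul]

variable {Ω : Set Space} {T : ℝ} {a : ℝ → Space → ℝ} {J G : ℝ → Space → Space}
  {m : ℝ → Space → Space} {M b : ℝ}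

namespace IsConserved

theorem shiftedEntropy_balance (hΩ : IsOpen Ω) (hΩb : Bornology.IsBounded Ω)
    (hcone : ∀ x₀ ∈ closure Ω, HasInwardConeAt Ω x₀) (hT : 0 < T) (h : IsConserved Ω T a J)
    (hM : ∀ t ∈ Icc 0 T, ∀ᵐ x ∂volume.restrict Ω, a t x ∈ Icc 0 M)
    (hG : HasL2H1Gradient Ω T (fun t x => √(a t x)) G) {δ : ℝ} (hδ : 0 < δ) (hb : b ∈ Icc 0 T) :
    (∫ x in Ω, shiftedEntropy δ (a b x)) - ∫ x in Ω, shiftedEntropy δ (a 0 x)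
      = ∫ p, inner ℝ (J p.1 p.2) (deriv (shiftedPotential δ) √(a p.1 p.2) • G p.1 p.2)
          ∂spaceTime Ω b := by
  have hΩv : volume Ω ≠ ⊤ := hΩb.measure_lt_top.ne
  have : IsFiniteMeasure (volume.restrict Ω) := isFiniteMeasure_restrict.2 hΩv
  have hF := contDiff_shiftedPotential hδ
  have hF' := abs_deriv_shiftedPotential_le hδ
  have hψ : ∀ᵐ t ∂volume.restrict (Ioo 0 T), IsC1Limit (volume.restrict Ω)
      (fun x => shiftedPotential δ √(a t x))
      fun x => deriv (shiftedPotential δ) √(a t x) • G t x := by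
    filter_upwards [hG.ae_gradient] with t ht
    exact (ht.isC1Limit hΩ hΩb hcone).comp_of_isBounded hΩb hF hF'
  refine h.chain_rule hΩ.measurableSet hT (K := fun t x =>
    deriv (shiftedPotential δ) √(a t x) • G t x) ?_ hψ
    (h.continuousInL2.continuousOn_integral_comp hΩv isCompact_Icc hM
      (continuous_shiftedEntropy.comp (Continuous.prodMk_right δ))) ?_ hb
  · refine hG.memLp_gradient.of_le_mul (c := 1 + 1 / δ)
      (((hF.continuous_deriv le_rfl).comp_aestronglyMeasurable hG.memLp.1).smul
        hG.memLp_gradient.1) (.of_forall fun p => ?_)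
    rw [norm_smul]
    exact mul_le_mul_of_nonneg_right (hF' _) (norm_nonneg _)
  · filter_upwards [ae_restrict_mem measurableSet_Ioo, hψ] with t ht hψt s hs
    have htT := Ioo_subset_Icc_self ht
    exact integral_mul_shiftedPotential_sub_le hδ (h.continuousInL2 t htT).1
      (h.continuousInL2 s hs).1 (hM t htT) (hM s hs) hψt.memLp

theorem entropy_balance (hΩ : IsOpen Ω) (hΩb : Bornology.IsBounded Ω)
    (hcone : ∀ x₀ ∈ closure Ω, HasInwardConeAt Ω x₀) (hT : 0 < T)
    (h : IsConserved Ω T a fun t x => √(a t x) • m t x)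
    (hM : ∀ᵐ p ∂spaceTime Ω T, a p.1 p.2 ∈ Icc 0 M)
    (hm : MemLp (fun p : ℝ × Space => m p.1 p.2) 2 (spaceTime Ω T))
    (hG : HasL2H1Gradient Ω T (fun t x => √(a t x)) G) (hb : b ∈ Icc 0 T) :
    (∫ x in Ω, entropyDensity (a b x)) - ∫ x in Ω, entropyDensity (a 0 x)
      = ∫ p, 2 * inner ℝ (√(a p.1 p.2) • velocity (a p.1 p.2) (m p.1 p.2)) (G p.1 p.2)
          ∂spaceTime Ω b := by
  have : IsFiniteMeasure (volume.restrict Ω) :=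
    isFiniteMeasure_restrict.2 hΩb.measure_lt_top.ne
  have hM' : ∀ t ∈ Icc 0 T, ∀ᵐ x ∂volume.restrict Ω, a t x ∈ Icc 0 M := fun t ht =>
    h.continuousInL2.ae_mem_of_isClosed hT isClosed_Icc (Measure.ae_ae_of_ae_prod hM) ht
  have hMb : ∀ᵐ p ∂spaceTime Ω b, a p.1 p.2 ∈ Icc 0 M := ae_mono (spaceTime_mono hb.2) hM
  have hmeas : AEStronglyMeasurable (fun p : ℝ × Space => a p.1 p.2) (spaceTime Ω b) :=
    ((hG.memLp.1.mono_measure (spaceTime_mono hb.2)).pow 2).congr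
      (hMb.mono fun p hp => Real.sq_sqrt hp.1)
  have hentropy : ∀ t ∈ Icc 0 T, Tendsto (fun δ => ∫ x in Ω, shiftedEntropy δ (a t x)) (𝓝[>] 0)
      (𝓝 (∫ x in Ω, entropyDensity (a t x))) := fun t ht =>
    tendsto_integral_shiftedEntropy (h.continuousInL2 t ht).1.1 isCompact_Icc (hM' t ht)
  have hflux := tendsto_integral_div_add_mul hmeas (((integrable_inner hm
    hG.memLp_gradient).mono_measure (spaceTime_mono hb.2)).const_mul 2)
    (hMb.mono fun p hp => hp.1)
  have hlimit : ∀ p : ℝ × Space, (if 0 < a p.1 p.2 then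
      2 * inner ℝ (m p.1 p.2) (G p.1 p.2) else 0) =
      2 * inner ℝ (√(a p.1 p.2) • velocity (a p.1 p.2) (m p.1 p.2)) (G p.1 p.2) := fun p => by
    rw [sqrt_smul_velocity]
    split_ifs <;> simp
  simp only [hlimit] at hflux
  refine tendsto_nhds_unique ((hentropy b hb).sub (hentropy 0 ⟨le_rfl, hT.le⟩))
    (hflux.congr' ?_)
  filter_upwards [self_mem_nhdsWithin] with δ (hδ : 0 < δ)
  rw [h.shiftedEntropy_balance hΩ hΩb hcone hT hM' hG hδ hb]
  refine integral_congr_ae (hMb.mono fun p hp => ?_)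
  simp only [deriv_shiftedPotential hδ, real_inner_smul_left, real_inner_smul_right,
    Real.sq_sqrt hp.1]
  linear_combination
    (-2 / (a p.1 p.2 + δ) * inner ℝ (m p.1 p.2) (G p.1 p.2)) * Real.mul_self_sqrt hp.1

end IsConserved

end EntropyBalance

section Friction

section Algebra

variable {ι E : Type*} [Fintype ι] [NormedAddCommGroup E] [InnerProductSpace ℝ E]

theorem sum_inner_sum_smul_sub {e : ι → ι → ℝ} (he : ∀ i j, e i j = e j i) (s : ι → ℝ)
    (m : ι → E) :
    ∑ i, inner ℝ (m i) (∑ j, (e i j * s j) • (s j • m i - s i • m j)) =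
      1 / 2 * ∑ i, ∑ j, e i j * ‖s j • m i - s i • m j‖ ^ 2 := by
  have hexpand : ∑ i, inner ℝ (m i) (∑ j, (e i j * s j) • (s j • m i - s i • m j)) =
      ∑ i, ∑ j, e i j * inner ℝ (s j • m i) (s j • m i - s i • m j) := by
    simp only [inner_sum, real_inner_smul_left, inner_smul_right_eq_smul, smul_eq_mul, mul_assoc]
  have hswap : ∑ i, ∑ j, e i j * inner ℝ (s j • m i) (s j • m i - s i • m j) =
      ∑ i, ∑ j, e i j * inner ℝ (s i • m j) (s i • m j - s j • m i) := by
    rw [Finset.sum_comm]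
    simp only [he]
  have hsplit : ∑ i, ∑ j, e i j * ‖s j • m i - s i • m j‖ ^ 2 =
      (∑ i, ∑ j, e i j * inner ℝ (s j • m i) (s j • m i - s i • m j)) +
      ∑ i, ∑ j, e i j * inner ℝ (s i • m j) (s i • m j - s j • m i) := by
    simp only [← Finset.sum_add_distrib, ← mul_add, ← real_inner_self_eq_norm_sq,
      inner_sub_left, inner_sub_right]
    refine Finset.sum_congr rfl fun i _ => Finset.sum_congr rfl fun j _ => ?_
    ring
  rw [hexpand, hsplit, ← hswap]
  ring

theorem sum_norm_sq_eq {s : ι → ℝ} (hs : ∑ i, s i ^ 2 = 1) {m : ι → E}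
    (hm : ∑ i, s i • m i = 0) :
    ∑ i, ‖m i‖ ^ 2 = 1 / 2 * ∑ i, ∑ j, ‖s j • m i - s i • m j‖ ^ 2 := by
  have hproj : ∀ i, ∑ j, s j • (s j • m i - s i • m j) = m i := fun i => by
    simp only [smul_sub, Finset.sum_sub_distrib, smul_comm _ (s i), ← Finset.smul_sum, hm,
      smul_zero, sub_zero]
    simp only [smul_smul, ← Finset.sum_smul, ← pow_two, hs, one_smul]
  simpa only [one_mul, hproj, real_inner_self_eq_norm_sq] using
    sum_inner_sum_smul_sub (e := fun _ _ => 1) (fun _ _ => rfl) s m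

end Algebra

variable {n : ℕ} {E : Type*} [NormedAddCommGroup E] [InnerProductSpace ℝ E]
  {D : Fin n → Fin n → ℝ} {a : Fin n → ℝ}

theorem sum_frictionMatrix_smul (D : Fin n → Fin n → ℝ) (ha : ∀ i, 0 ≤ a i) (m : Fin n → E)
    (i : Fin n) : ∑ j, frictionMatrix D a i j • m j =
      ∑ j, ((D i j)⁻¹ * √(a j)) • (√(a j) • m i - √(a i) • m j) := by
  rw [← Finset.add_sum_erase _ _ (Finset.mem_univ i),
    ← Finset.add_sum_erase _ _ (Finset.mem_univ i), sub_self, smul_zero, zero_add]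
  simp only [frictionMatrix, if_true]
  rw [Finset.sum_smul, ← Finset.sum_add_distrib]
  refine Finset.sum_congr rfl fun j hj => ?_
  rw [if_neg (Finset.ne_of_mem_erase hj).symm, smul_sub, smul_smul, smul_smul, sub_eq_add_neg,
    ← neg_smul, Real.sqrt_mul (ha i), mul_assoc _ √(a j) √(a j), Real.mul_self_sqrt (ha j)]
  congr 2 <;> ring

theorem sum_inner_sum_frictionMatrix_smul (hD : IsDiffusivity D) (ha : ∀ i, 0 ≤ a i)
    (m : Fin n → E) :
    ∑ i, inner ℝ (m i) (∑ j, frictionMatrix D a i j • m j) =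
      1 / 2 * ∑ i, ∑ j, (D i j)⁻¹ * ‖√(a j) • m i - √(a i) • m j‖ ^ 2 := by
  simp only [sum_frictionMatrix_smul D ha]
  exact sum_inner_sum_smul_sub (fun i j => by rw [hD.symm]) (fun i => √(a i)) m

theorem IsDiffusivity.exists_pos_le_inv (hD : IsDiffusivity D) :
    ∃ κ : ℝ, 0 < κ ∧ ∀ i j, i ≠ j → κ ≤ (D i j)⁻¹ := by
  obtain ⟨B, hB⟩ := (finite_range fun p : Fin n × Fin n => D p.1 p.2).bddAbove
  refine ⟨(max B 1)⁻¹, by positivity, fun i j hij => inv_anti₀ (hD.pos i j hij) ?_⟩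
  exact (hB (mem_range_self (i, j))).trans (le_max_left _ _)

theorem mul_sum_norm_sq_le_sum_inner_frictionMatrix (hD : IsDiffusivity D) {κ : ℝ}
    (hκ : ∀ i j, i ≠ j → κ ≤ (D i j)⁻¹) (ha : ∀ i, 0 ≤ a i) (hsum : ∑ i, a i = 1)
    {m : Fin n → E} (hm : ∑ i, √(a i) • m i = 0) :
    κ * ∑ i, ‖m i‖ ^ 2 ≤ ∑ i, inner ℝ (m i) (∑ j, frictionMatrix D a i j • m j) := by
  rw [sum_norm_sq_eq (s := fun i => √(a i)) (by simpa only [Real.sq_sqrt (ha _)] using hsum) hm,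
    sum_inner_sum_frictionMatrix_smul hD ha, mul_left_comm]
  simp only [Finset.mul_sum _ _ κ]
  refine mul_le_mul_of_nonneg_left
    (Finset.sum_le_sum fun i _ => Finset.sum_le_sum fun j _ => ?_) (by norm_num)
  rcases eq_or_ne i j with rfl | hij
  · simp
  · exact mul_le_mul_of_nonneg_right (hκ i j hij) (by positivity)

theorem sqrt_sum_norm_sq_le_of_friction (hD : IsDiffusivity D) {κ : ℝ} (hκ₀ : 0 < κ)
    (hκ : ∀ i j, i ≠ j → κ ≤ (D i j)⁻¹) (ha : ∀ i, 0 ≤ a i) (hsum : ∑ i, a i = 1)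
    {m G : Fin n → E} (hsys : ∀ i, -∑ j, frictionMatrix D a i j • m j = (2 : ℝ) • G i)
    (hm : ∑ i, √(a i) • m i = 0) :
    √(∑ i, ‖m i‖ ^ 2) ≤ 2 / κ * √(∑ i, ‖G i‖ ^ 2) := by
  have hquad : κ * √(∑ i, ‖m i‖ ^ 2) ^ 2 ≤
      2 * (√(∑ i, ‖m i‖ ^ 2) * √(∑ i, ‖G i‖ ^ 2)) := by
    rw [Real.sq_sqrt (by positivity)]
    calc κ * ∑ i, ‖m i‖ ^ 2
        ≤ ∑ i, inner ℝ (m i) (∑ j, frictionMatrix D a i j • m j) :=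
          mul_sum_norm_sq_le_sum_inner_frictionMatrix hD hκ ha hsum hm
      _ = ∑ i, 2 * -inner ℝ (m i) (G i) := by
          simp only [neg_eq_iff_eq_neg.1 (hsys _), inner_neg_right, real_inner_smul_right,
            mul_neg]
      _ ≤ ∑ i, 2 * (‖m i‖ * ‖G i‖) := Finset.sum_le_sum fun i _ => by
          linarith [neg_le_abs (inner ℝ (m i) (G i)), abs_real_inner_le_norm (m i) (G i)]
      _ ≤ 2 * (√(∑ i, ‖m i‖ ^ 2) * √(∑ i, ‖G i‖ ^ 2)) := by
          rw [← Finset.mul_sum]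
          exact mul_le_mul_of_nonneg_left (Real.sum_mul_le_sqrt_mul_sqrt _ _ _) zero_le_two
  rcases (Real.sqrt_nonneg (∑ i, ‖m i‖ ^ 2)).eq_or_lt with hzero | hpos
  · rw [← hzero]
    positivity
  · rw [div_mul_eq_mul_div, le_div_iff₀ hκ₀]
    refine le_of_mul_le_mul_left ?_ hpos
    linarith

end Friction

section Dissipation

variable {n : ℕ} {D : Fin n → Fin n → ℝ} {c : Fin n → ℝ → Space → ℝ}
  {m : Fin n → ℝ → Space → Space} {t : ℝ} {x : Space}

theorem inner_sum_frictionMatrix_smul_velocity (D : Fin n → Fin n → ℝ) {a : Fin n → ℝ}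
    (ha : ∀ i, 0 ≤ a i) (v : Fin n → Space) (i : Fin n) :
    inner ℝ (√(a i) • velocity (a i) (v i)) (∑ j, frictionMatrix D a i j • v j) =
      inner ℝ (√(a i) • velocity (a i) (v i))
        (∑ j, frictionMatrix D a i j • √(a j) • velocity (a j) (v j)) := by
  rcases (ha i).eq_or_lt with hi | hi
  · simp [← hi]
  · congr 1
    refine Finset.sum_congr rfl fun j _ => ?_
    rw [sqrt_smul_velocity]
    split_ifs with hj
    · rfl
    · have hzero := le_antisymm (not_lt.1 hj) (ha j)
      have hij : i ≠ j := fun hij => hi.ne' (hij ▸ hzero)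
      simp [frictionMatrix, hij, hzero]

theorem dissipation_eq (D : Fin n → Fin n → ℝ) (m : Fin n → ℝ → Space → Space)
    (hc : ∀ i, 0 ≤ c i t x) (i j : Fin n) :
    dissipation D c m i j t x = (D i j)⁻¹ *
      ‖√(c j t x) • √(c i t x) • velocity (c i t x) (m i t x)
        - √(c i t x) • √(c j t x) • velocity (c j t x) (m j t x)‖ ^ 2 := by
  rw [smul_comm √(c j t x), ← smul_sub, ← smul_sub, norm_smul, norm_smul, mul_pow, mul_pow,
    Real.norm_eq_abs, Real.norm_eq_abs, sq_abs, sq_abs, Real.sq_sqrt (hc i), Real.sq_sqrt (hc j),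
    dissipation]
  ring

theorem sum_inner_eq_neg_dissipation (hD : IsDiffusivity D) (hc : ∀ i, 0 ≤ c i t x)
    {G : Fin n → Space}
    (hsys : ∀ i, -∑ j, frictionMatrix D (fun k => c k t x) i j • m j t x = (2 : ℝ) • G i) :
    ∑ i, 2 * inner ℝ (√(c i t x) • velocity (c i t x) (m i t x)) (G i) =
      -(1 / 2 * ∑ i, ∑ j, dissipation D c m i j t x) := by
  simp only [dissipation_eq D m hc]
  rw [← sum_inner_sum_frictionMatrix_smul hD hc, ← Finset.sum_neg_distrib]
  refine Finset.sum_congr rfl fun i _ => ?_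
  rw [← inner_sum_frictionMatrix_smul_velocity D hc fun k => m k t x, ← inner_neg_right, hsys,
    real_inner_smul_right]

end Dissipation

section WeakSolution

theorem memLp_sqrt_smul {α : Type*} [MeasurableSpace α] {μ : Measure α} {f : α → ℝ}
    {v : α → Space} {p : ℝ≥0∞} (hf : AEStronglyMeasurable f μ) (hf1 : ∀ᵐ x ∂μ, f x ≤ 1)
    (hv : MemLp v p μ) : MemLp (fun x => √(f x) • v x) p μ := by
  refine hv.of_le ((Real.continuous_sqrt.comp_aestronglyMeasurable hf).smul hv.1) ?_
  filter_upwards [hf1] with x hx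
  rw [norm_smul, Real.norm_of_nonneg (Real.sqrt_nonneg _)]
  exact mul_le_of_le_one_left (norm_nonneg _) (Real.sqrt_le_one.2 hx)

theorem memLp_sqrt_smul_velocity {α : Type*} [MeasurableSpace α] {μ : Measure α} {f : α → ℝ}
    {v : α → Space} {p : ℝ≥0∞} (hf : AEStronglyMeasurable f μ) (hv : MemLp v p μ) :
    MemLp (fun x => √(f x) • velocity (f x) (v x)) p μ := by
  have hsqrt := Real.continuous_sqrt.comp_aestronglyMeasurable hf
  refine hv.of_le (hsqrt.smul (hsqrt.aemeasurable.inv.aestronglyMeasurable.smul hv.1))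
    (.of_forall fun x => ?_)
  rw [sqrt_smul_velocity]
  split_ifs
  · exact le_rfl
  · rw [norm_zero]
    exact norm_nonneg _

variable {n : ℕ} {Ω : Set Space} {T : ℝ} {D : Fin n → Fin n → ℝ} {c₀ : Fin n → Space → ℝ}
  {c : Fin n → ℝ → Space → ℝ} {m : Fin n → ℝ → Space → Space}

namespace IsWeakSolution

theorem ae_mem_Icc (hc : IsWeakSolution Ω T D c₀ c m) :
    ∀ᵐ p ∂spaceTime Ω T, ∀ i, c i p.1 p.2 ∈ Icc 0 1 := by
  filter_upwards [eventually_all.2 hc.nonneg, hc.sum_eq_one] with p hnonneg hsum i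
  refine ⟨hnonneg i, ?_⟩
  rw [← hsum]
  exact Finset.single_le_sum (f := fun i => c i p.1 p.2) (fun j _ => hnonneg j)
    (Finset.mem_univ i)

theorem memLp_velocity (hD : IsDiffusivity D) (hc : IsWeakSolution Ω T D c₀ c m) (i : Fin n) :
    MemLp (fun p : ℝ × Space => m i p.1 p.2) 2 (spaceTime Ω T) := by
  obtain ⟨G, hG, hsys⟩ := hc.friction
  obtain ⟨κ, hκ₀, hκ⟩ := hD.exists_pos_le_inv
  have hsumG : MemLp (fun p : ℝ × Space => ∑ j, ‖G j p.1 p.2‖) 2 (spaceTime Ω T) :=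
    memLp_finsetSum _ fun j _ => (hG j).memLp_gradient.norm
  refine hsumG.of_le_mul (c := 2 / κ) (hc.measurable_m i) ?_
  filter_upwards [hsys, eventually_all.2 hc.nonneg, hc.sum_eq_one] with p hp hnonneg hsum
  have hG0 : 0 ≤ ∑ j, ‖G j p.1 p.2‖ := by positivity
  calc ‖m i p.1 p.2‖
      ≤ √(∑ j, ‖m j p.1 p.2‖ ^ 2) := Real.le_sqrt_of_sq_le <|
        Finset.single_le_sum (f := fun j => ‖m j p.1 p.2‖ ^ 2) (fun j _ => by positivity)
          (Finset.mem_univ i)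
    _ ≤ 2 / κ * √(∑ j, ‖G j p.1 p.2‖ ^ 2) :=
        sqrt_sum_norm_sq_le_of_friction hD hκ₀ hκ hnonneg hsum hp.1 hp.2
    _ ≤ 2 / κ * ‖∑ j, ‖G j p.1 p.2‖‖ := by
        rw [Real.norm_of_nonneg hG0]
        gcongr
        exact Real.sqrt_le_iff.2
          ⟨hG0, Finset.sum_sq_le_sq_sum_of_nonneg fun j _ => norm_nonneg _⟩

theorem isConserved (hD : IsDiffusivity D) (hc : IsWeakSolution Ω T D c₀ c m) (i : Fin n) :
    IsConserved Ω T (c i) fun t x => √(c i t x) • m i t x where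
  continuousInL2 := hc.continuousInL2 i
  memLp_flux := memLp_sqrt_smul (hc.bounded i).1 (hc.ae_mem_Icc.mono fun _ hp => (hp i).2)
    (hc.memLp_velocity hD i)
  weak_form := hc.weak_form i

theorem integrable_dissipation (hD : IsDiffusivity D) (hc : IsWeakSolution Ω T D c₀ c m)
    (i j : Fin n) :
    Integrable (fun p : ℝ × Space => dissipation D c m i j p.1 p.2) (spaceTime Ω T) := by
  have hterm : ∀ i j, MemLp (fun p : ℝ × Space => √(c j p.1 p.2) • √(c i p.1 p.2) •
      velocity (c i p.1 p.2) (m i p.1 p.2)) 2 (spaceTime Ω T) := fun i j =>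
    memLp_sqrt_smul (hc.bounded j).1 (hc.ae_mem_Icc.mono fun _ hp => (hp j).2)
      (memLp_sqrt_smul_velocity (hc.bounded i).1 (hc.memLp_velocity hD i))
  refine ((((hterm i j).sub (hterm j i)).integrable_norm_pow two_ne_zero).const_mul
    (D i j)⁻¹).congr (hc.ae_mem_Icc.mono fun p hp => ?_)
  exact (dissipation_eq D m (fun k => (hp k).1) i j).symm

theorem integrableOn_entropyDensity (hΩ : volume Ω ≠ ⊤) (hT : 0 < T)
    (hc : IsWeakSolution Ω T D c₀ c m) (i : Fin n) {t : ℝ} (ht : t ∈ Icc 0 T) :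
    IntegrableOn (fun x => entropyDensity (c i t x)) Ω := by
  have : IsFiniteMeasure (volume.restrict Ω) := isFiniteMeasure_restrict.2 hΩ
  rw [← shiftedEntropy_zero]
  exact integrable_comp_of_isCompact (continuous_shiftedEntropy.comp (Continuous.prodMk_right 0))
    (hc.continuousInL2 i t ht).1.1 isCompact_Icc
    ((hc.continuousInL2 i).ae_mem_of_isClosed hT isClosed_Icc
      (Measure.ae_ae_of_ae_prod (hc.ae_mem_Icc.mono fun _ hp => hp i)) ht)

theorem entropy_initial (hc : IsWeakSolution Ω T D c₀ c m) :
    entropy Ω (fun i => c i 0) = entropy Ω c₀ :=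
  Finset.sum_congr rfl fun i _ => integral_congr_ae ((hc.initial i).fun_comp entropyDensity)

theorem entropy_sub_eq (hΩ : IsOpen Ω) (hΩb : Bornology.IsBounded Ω)
    (hcone : ∀ x₀ ∈ closure Ω, HasInwardConeAt Ω x₀) (hT : 0 < T) (hD : IsDiffusivity D)
    (hc : IsWeakSolution Ω T D c₀ c m) {t : ℝ} (ht : t ∈ Icc 0 T) :
    entropy Ω (fun i => c i t) - entropy Ω c₀ =
      -(1 / 2 * ∑ i, ∑ j, ∫ p, dissipation D c m i j p.1 p.2 ∂spaceTime Ω t) := by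
  obtain ⟨G, hG, hsys⟩ := hc.friction
  have hle : spaceTime Ω t ≤ spaceTime Ω T := spaceTime_mono ht.2
  have hdiss := fun i j => (hc.integrable_dissipation hD i j).mono_measure hle
  have hprod : ∀ i, Integrable (fun p : ℝ × Space => 2 * inner ℝ
      (√(c i p.1 p.2) • velocity (c i p.1 p.2) (m i p.1 p.2)) (G i p.1 p.2)) (spaceTime Ω t) :=
    fun i => ((integrable_inner (memLp_sqrt_smul_velocity (hc.bounded i).1
      (hc.memLp_velocity hD i)) (hG i).memLp_gradient).mono_measure hle).const_mul 2
  calc entropy Ω (fun i => c i t) - entropy Ω c₀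
      = ∑ i, ∫ p, 2 * inner ℝ (√(c i p.1 p.2) • velocity (c i p.1 p.2) (m i p.1 p.2))
          (G i p.1 p.2) ∂spaceTime Ω t := by
        rw [← hc.entropy_initial, entropy, entropy, ← Finset.sum_sub_distrib]
        exact Finset.sum_congr rfl fun i _ => (hc.isConserved hD i).entropy_balance hΩ hΩb hcone
          hT (hc.ae_mem_Icc.mono fun _ hp => hp i) (hc.memLp_velocity hD i) (hG i) ht
    _ = ∫ p, -(1 / 2 * ∑ i, ∑ j, dissipation D c m i j p.1 p.2) ∂spaceTime Ω t := by
        rw [← integral_finsetSum _ fun i _ => hprod i]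
        refine integral_congr_ae ?_
        filter_upwards [ae_mono hle hsys, ae_mono hle hc.ae_mem_Icc] with p hp hnonneg
        exact sum_inner_eq_neg_dissipation hD (fun i => (hnonneg i).1) hp.1
    _ = -(1 / 2 * ∑ i, ∑ j, ∫ p, dissipation D c m i j p.1 p.2 ∂spaceTime Ω t) := by
        rw [integral_neg, integral_const_mul,
          integral_finsetSum _ fun i _ => integrable_finsetSum _ fun j _ => hdiss i j]
        simp only [integral_finsetSum _ fun j _ => hdiss _ j]

end IsWeakSolution

end WeakSolution

end MaxwellStefan

open MaxwellStefan in
theorem theorem1_general {n : ℕ} {Ω : Set Space} (hΩ : IsOpen Ω)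
    (hΩb : Bornology.IsBounded Ω) (hcone : ∀ x₀ ∈ closure Ω, HasInwardConeAt Ω x₀)
    {T : ℝ} (hT : 0 < T) {D : Fin n → Fin n → ℝ} (hD : IsDiffusivity D)
    {c₀ : Fin n → Space → ℝ} {c : Fin n → ℝ → Space → ℝ} {m : Fin n → ℝ → Space → Space}
    (hc : IsWeakSolution Ω T D c₀ c m) :
    (∀ i, IntegrableOn (fun x => entropyDensity (c₀ i x)) Ω) ∧
    ∀ t ∈ Ioc 0 T,
      (∀ i, IntegrableOn (fun x => entropyDensity (c i t x)) Ω) ∧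
      (∀ i j, IntegrableOn (fun p : ℝ × Space => dissipation D c m i j p.1 p.2)
        (Ioo 0 t ×ˢ Ω)) ∧
      entropy Ω (fun i => c i t) +
        1 / 2 * ∑ i, ∑ j, ∫ s in Ioo 0 t, ∫ x in Ω, dissipation D c m i j s x
      = entropy Ω c₀ := by
  have hΩv : volume Ω ≠ ⊤ := hΩb.measure_lt_top.ne
  refine ⟨fun i => ?_, fun t ht => ?_⟩
  · exact (hc.integrableOn_entropyDensity hΩv hT i ⟨le_rfl, hT.le⟩).congr
      ((hc.initial i).fun_comp entropyDensity)
  have htT := Ioc_subset_Icc_self ht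
  have hdiss := fun i j => (hc.integrable_dissipation hD i j).mono_measure (spaceTime_mono ht.2)
  refine ⟨fun i => hc.integrableOn_entropyDensity hΩv hT i htT, fun i j => ?_, ?_⟩
  · rw [IntegrableOn, Measure.volume_eq_prod, ← spaceTime_eq_restrict]
    exact hdiss i j
  · have hbalance := hc.entropy_sub_eq hΩ hΩb hcone hT hD htT
    simp only [spaceTime, integral_prod _ (hdiss _ _)] at hbalance
    linarith

theorem theorem1 {n : ℕ} (Ω : Set MaxwellStefan.Space)
    (hΩ : MaxwellStefan.IsBoundedSmoothDomain Ω) (T : ℝ) (hT : 0 < T)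
    (D : Fin n → Fin n → ℝ) (hD : MaxwellStefan.IsDiffusivity D)
    (c₀ : Fin n → MaxwellStefan.Space → ℝ)
    (hc₀_nonneg : ∀ i, ∀ᵐ x ∂(volume.restrict Ω), 0 ≤ c₀ i x)
    (hc₀_sum : ∀ᵐ x ∂(volume.restrict Ω), ∑ i, c₀ i x = 1)
    (c : Fin n → ℝ → MaxwellStefan.Space → ℝ)
    (m : Fin n → ℝ → MaxwellStefan.Space → MaxwellStefan.Space)
    (hc : MaxwellStefan.IsWeakSolution Ω T D c₀ c m) :
    (∀ i, IntegrableOn (fun x => MaxwellStefan.entropyDensity (c₀ i x)) Ω) ∧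
    ∀ t ∈ Ioc 0 T,
      (∀ i, IntegrableOn (fun x => MaxwellStefan.entropyDensity (c i t x)) Ω) ∧
      (∀ i j, IntegrableOn
        (fun p : ℝ × MaxwellStefan.Space => MaxwellStefan.dissipation D c m i j p.1 p.2)
        (Ioo 0 t ×ˢ Ω)) ∧
      MaxwellStefan.entropy Ω (fun i => c i t) +
        1 / 2 * ∑ i, ∑ j, ∫ s in Ioo 0 t, ∫ x in Ω, MaxwellStefan.dissipation D c m i j s x
      = MaxwellStefan.entropy Ω c₀ :=
  theorem1_general hΩ.isOpen hΩ.isBounded (fun _ => hΩ.hasInwardConeAt) hT hD hc
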